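/- **Setting.** A game graph $G=(V,E)$ has a finite non-empty node set $V=V_0\uplus V_1$ and edges $E\subseteq V\times V$ such that every node has an outgoing edge; $E(v)$ is the set of outgoing edges of $v$. Let $k\ge 1$ and $W\ge 1$ be integers and $w_1,\dots,w_k:E\to[-W;W]$ integer weight functions. For a path $v_0\dots v_n$ put $\mathrm{avg}_w(v_0\dots v_n)=\frac1n\sum_{j<n}w(v_j,v_{j+1})$, and let $\mathit{MP}(w)$ be the set of plays $\rho$ with $\limsup_{n\to\infty}\mathrm{avg}_w(\rho[0;n])\ge 0$. A strategy (of Player 0) maps each history ending in $v\in V_0$ to an edge in $E(v)$. It is winning in $(G,\varphi)$ if every play that follows it from a node of $\mathrm{Win}(G,\varphi)$ lies in $\varphi$, where $\mathrm{Win}(G,\varphi)$ is the set of nodes from which some strategy ensures $\varphi$. **Templates.** A QaSTel is a map $\Pi:V\times\mathbb N_\infty\to 2^E$ with $\Pi(u,c)\subseteq E(u)$, monotone in $c$; its activation function is $act_\Pi(e)=\min\{c \mid e\in\Pi(u,c') \text{ for all } c'\ge c\}$ for $e\in E(u)$. Put $l\ominus w=\max(l-w,0)$, $\infty\ominus w=\infty$.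 For $\mu:E\to\mathbb N_\infty$ and $e=(u,v)$ let $\mathbb O_E(\mu)(e)$ be $\min_{e'\in E(v)}\mu(e')\ominus w(e)$ if $v\in V_0$ and $\max_{e'\in E(v)}\mu(e')\ominus w(e)$ if $v\in V_1$, with values above $|V|\cdot W$ replaced by $\infty$. $\textsc{computeQaSTel}(G,w,\mu_{in})$ iterates $\mu\mapsto\max(\mu,\mathbb O_E(\mu))$ from $\mu_{in}$ to its limit $\mu$ and returns the region $\{v\in V_0\mid\exists e\in E(v).\ \mu(e)\ne\infty\}\cup\{v\in V_1\mid\forall e\in E(v).\ \mu(e)\neq\infty\}$ and the QaSTel $\Pi(u,c)=\{e\in E(u)\mid c\ge\mu(e)\}$. $\textsc{ExtractStrat}(\Pi)$ picks at each $v\in V_0$ an edge of $E(v)$ with smallest activation value. $\textsc{Combine}(\pi_1,\dots,\pi_k)$ plays in phases $p=0,1,2,\dots$; in phase $p$ it plays $\pi_i$ with $i\equiv p+1 \pmod k$, and the phase ends at the first move after which the average weight of the whole play so far with respect to $w_i$ is at least $-\frac1{p+1}$. **The procedure** $\textsc{CombineQaSTel}(G,\{\mathit{MP}(w_i)\}_{i})$: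 set $\mathcal W:=V$, $(\mathcal W_i,\Pi_i):=\textsc{computeQaSTel}(G,w_i,0)$ for all $i$, and $\mathcal W':=\bigcap_i\mathcal W_i$. While $\mathcal W\ne\mathcal W'$: set $act_{\Pi_i}(e):=\infty$ for all $i$ and all edges $e\in\mathcal W'\times(\mathcal W\setminus\mathcal W')$; set $(\mathcal W_i,\Pi_i):=\textsc{computeQaSTel}(G,w_i,act_{\Pi_i})$ for all $i$; set $\mathcal W:=\mathcal W'$ and then $\mathcal W':=\bigcap_i\mathcal W_i$. Finally let $\pi_i:=\textsc{ExtractStrat}(\Pi_i)$ and return $\textsc{Combine}(\pi_1,\dots,\pi_k)$. **Theorem.** Every strategy returned by $\textsc{CombineQaSTel}(G,\{\mathit{MP}(w_i)\}_{i\in[1;k]})$ is winning in the game $(G,\bigwedge_{i\in[1;k]}\mathit{MP}(w_i))$. Furthermore, the procedure terminates in time $\mathcal O(k\cdot|V|\cdot|E|\cdot W)$: there is a universal constant $C$ such that on every input the procedure, with $\textsc{computeQaSTel}$ implemented by a work list of nodes and counters, halts after at most $C\cdot k\cdot|V|\cdot|E|\cdot W$ elementary steps (unit-cost memory accesses and loop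 tests, with the graph given by adjacency lists), and the positional strategies $\pi_1,\dots,\pi_k$ then stored represent a strategy returned by $\textsc{CombineQaSTel}$. -/

import Mathlib

open Filter

noncomputable section

/-! ### Game graphs, plays, strategies, objectives -/

/-- A two-player game graph on the node set `V`: `V0` are the nodes of Player 0, all other nodes
belong to Player 1, and `E` is the set of edges. -/
structure GameGraph (V : Type) where
  V0 : Finset V
  E : Finset (V × V)

namespace GameGraph

variable {V : Type} [Fintype V] [DecidableEq V] (G : GameGraph V)

/-- The type of edges of `G`. -/
abbrev Edge : Type := {e : V × V // e ∈ G.E}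

variable {G} in
/-- Source node of an edge. -/
abbrev Edge.src (e : G.Edge) : V := e.1.1

variable {G} in
/-- Target node of an edge. -/
abbrev Edge.dst (e : G.Edge) : V := e.1.2

/-- `E(v)`, the outgoing edges of `v`. -/
def outEdges (v : V) : Finset G.Edge := Finset.univ.filter fun e => e.src = v

/-- The incoming edges of `v`. -/
def inEdges (v : V) : Finset G.Edge := Finset.univ.filter fun e => e.dst = v

/-- `ρ` is a play: an infinite sequence of nodes along edges. -/
def IsPlay (ρ : ℕ → V) : Prop := ∀ j, (ρ j, ρ (j + 1)) ∈ G.E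

/-- A strategy of Player 0. After the history `H · v` with `v` a Player-0 node the play moves along
the edge `(v, next H v)`; the values of `next` at Player-1 nodes are never used. -/
structure Strategy where
  next : List V → V → V
  valid : ∀ H v, v ∈ G.V0 → (v, next H v) ∈ G.E

/-- A positional strategy of Player 0. -/
structure Positional where
  next : V → V
  valid : ∀ v, v ∈ G.V0 → (v, next v) ∈ G.E

end GameGraph

/-- The prefix `ρ[0;n] = v₀ … vₙ` of an infinite sequence. -/
def playPrefix {V : Type} (ρ : ℕ → V) (n : ℕ) : List V := (List.range (n + 1)).map ρ

/-- The weight of a finite path `v₀ … vₙ`, the sum of the weights of its edges. -/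
def pathWeight {V : Type} (w : V × V → ℤ) : List V → ℤ
  | a :: b :: l => w (a, b) + pathWeight w (b :: l)
  | _ => 0

/-- The average weight of a finite path `v₀ … vₙ`, which has `n` edges. -/
def pathAvg {V : Type} (w : V × V → ℤ) (l : List V) : ℝ :=
  (pathWeight w l : ℝ) / ((l.length : ℝ) - 1)

/-- The mean-payoff objective `MP(w)`. -/
def MeanPayoff {V : Type} (w : V × V → ℤ) : Set (ℕ → V) :=
  {ρ | (0 : EReal) ≤ limsup (fun n => ((pathAvg w (playPrefix ρ n) : ℝ) : EReal)) atTop}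

namespace GameGraph

variable {V : Type} [Fintype V] [DecidableEq V] {G : GameGraph V}

/-- `ρ` is a `π`-play. The history before time `j` is `v₀ … v_{j-1}`. -/
def Strategy.IsPlay (π : G.Strategy) (ρ : ℕ → V) : Prop :=
  G.IsPlay ρ ∧ ∀ j, ρ j ∈ G.V0 → ρ (j + 1) = π.next ((List.range j).map ρ) (ρ j)

/-- `π` is winning from the node `v` for the objective `φ`. -/
def Strategy.WinsFrom (π : G.Strategy) (φ : Set (ℕ → V)) (v : V) : Prop :=
  ∀ ρ, π.IsPlay ρ → ρ 0 = v → ρ ∈ φ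

variable (G) in
/-- The winning region `Win(G, φ)` of Player 0. -/
def winRegion (φ : Set (ℕ → V)) : Set V := {v | ∃ π : G.Strategy, π.WinsFrom φ v}

/-- `π` is winning in the game `(G, φ)`: it wins from every node of the winning region. -/
def Strategy.IsWinning (π : G.Strategy) (φ : Set (ℕ → V)) : Prop :=
  ∀ v ∈ G.winRegion φ, π.WinsFrom φ v

end GameGraph

/-! ### Quantitative strategy templates -/

/-- A QaSTel: it maps a node `u` and a credit `c` to the outgoing edges of `u` activated by `c`,
monotonically in `c`. -/
structure QaSTel {V : Type} (G : GameGraph V) where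
  allow : V → ℕ∞ → Set G.Edge
  src_eq : ∀ u c, ∀ e ∈ allow u c, e.src = u
  mono : ∀ u, Monotone (allow u)

/-- `act_Π(e)`: the smallest `c` such that `e` is activated by every credit in `[c; ∞]`. -/
def QaSTel.act {V : Type} {G : GameGraph V} (P : QaSTel G) (e : G.Edge) : ℕ∞ :=
  sInf {c | ∀ c' ≥ c, e ∈ P.allow e.src c'}

/-- The QaSTel extracted from an edge function: `Π(u, c) = {e ∈ E(u) | c ≥ μ(e)}`. -/
def QaSTel.ofEdgeFun {V : Type} {G : GameGraph V} (μ : G.Edge → ℕ∞) : QaSTel G where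
  allow u c := {e | e.src = u ∧ μ e ≤ c}
  src_eq _ _ _ he := he.1
  mono _ _ _ hc _ he := ⟨he.1, he.2.trans hc⟩

/-- `l ⊖ w = max (l - w) 0`, with `∞ ⊖ w = ∞`. -/
def ominus : ℕ∞ → ℤ → ℕ∞
  | ⊤, _ => ⊤
  | (l : ℕ), w => (((l : ℤ) - w).toNat : ℕ∞)

/-- Values above `B` are replaced by `∞`. -/
def truncAt (B : ℕ) (x : ℕ∞) : ℕ∞ := if x ≤ (B : ℕ∞) then x else ⊤

section Synthesis

variable {V : Type} [Fintype V] [DecidableEq V] (G : GameGraph V)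

/-- The edge-based value iteration operator. -/
def edgeOp (w : V × V → ℤ) (μ : G.Edge → ℕ∞) (e : G.Edge) : ℕ∞ :=
  if e.dst ∈ G.V0 then ⨅ e' ∈ G.outEdges e.dst, ominus (μ e') (w e)
  else ⨆ e' ∈ G.outEdges e.dst, ominus (μ e') (w e)

/-- One round of value iteration with cut-off `|V| · W`. Values are only ever raised; in particular
an edge whose value was set to `∞` keeps the value `∞`. -/
def liftOp (w : V × V → ℤ) (W : ℕ) (μ : G.Edge → ℕ∞) (e : G.Edge) : ℕ∞ :=
  max (μ e) (truncAt (Fintype.card V * W) (edgeOp G w μ e))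

/-- The result of value iteration started from `μin`: the limit of the increasing sequence of
iterates. -/
def fixPoint (w : V × V → ℤ) (W : ℕ) (μin : G.Edge → ℕ∞) (e : G.Edge) : ℕ∞ :=
  ⨆ t : ℕ, (liftOp G w W)^[t] μin e

/-- The region read off an edge function: Player-0 nodes with some outgoing edge of finite value and
Player-1 nodes all of whose outgoing edges have finite value. -/
def regionOf (μ : G.Edge → ℕ∞) : Set V :=
  {v | (v ∈ G.V0 ∧ ∃ e ∈ G.outEdges v, μ e ≠ ⊤) ∨ (v ∉ G.V0 ∧ ∀ e ∈ G.outEdges v, μ e ≠ ⊤)}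

/-- `computeQaSTel(G, w, μin)`: the region and the QaSTel obtained from the fixed point. -/
def computeQaSTel (w : V × V → ℤ) (W : ℕ) (μin : G.Edge → ℕ∞) : Set V × QaSTel G :=
  (regionOf G (fixPoint G w W μin), QaSTel.ofEdgeFun (fixPoint G w W μin))

variable {G}

/-- `π` is a possible outcome of `ExtractStrat`: at every Player-0 node it picks an outgoing edge
with the smallest activation value. -/
def IsExtracted (P : QaSTel G) (π : G.Positional) : Prop :=
  ∀ v (hv : v ∈ G.V0), ∀ e ∈ G.outEdges v, P.act ⟨(v, π.next v), π.valid v hv⟩ ≤ P.act e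

/-! ### Combining positional strategies

The combined strategy plays in phases `p = 0, 1, 2, …`. In phase `p` it plays the strategy for the
objective `p mod k`, until the average weight of the whole play so far for this objective is at least
`-1/(p+1)`; then the next phase begins. -/

/-- The objective served in phase `p`. -/
def phaseObj (k : ℕ) [NeZero k] (p : ℕ) : Fin k := ⟨p % k, Nat.mod_lt p (NeZero.pos k)⟩

open Classical in
/-- The phase after the first `t` moves of the path `h = v₀ v₁ …`. -/
def phaseAt {k : ℕ} [NeZero k] (w : Fin k → V × V → ℤ) (h : List V) : ℕ → ℕ
  | 0 => 0
  | t + 1 =>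
    if -(1 / ((phaseAt w h t : ℝ) + 1)) ≤ pathAvg (w (phaseObj k (phaseAt w h t))) (h.take (t + 2))
    then phaseAt w h t + 1 else phaseAt w h t

/-- `Combine(π₁, …, π_k)`. -/
def combineStrat {k : ℕ} [NeZero k] (w : Fin k → V × V → ℤ) (πs : Fin k → G.Positional) :
    G.Strategy where
  next H v := (πs (phaseObj k (phaseAt w (H ++ [v]) H.length))).next v
  valid _ v hv := (πs _).valid v hv

/-! ### The procedure `CombineQaSTel` -/

variable (G) in
/-- The variables of the main loop: the regions `𝒲` and `𝒲'` and the templates `Π_i`. -/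
structure LoopState (k : ℕ) where
  reg : Set V
  reg' : Set V
  tmpl : Fin k → QaSTel G

variable (G) in
/-- The values of the variables when the main loop is entered. -/
def loopStart {k : ℕ} (w : Fin k → V × V → ℤ) (W : ℕ) : LoopState G k where
  reg := Set.univ
  reg' := ⋂ i, (computeQaSTel G (w i) W fun _ => 0).1
  tmpl i := (computeQaSTel G (w i) W fun _ => 0).2

open Classical in
/-- The activation functions after all edges from `𝒲'` to `𝒲 \ 𝒲'` have been set to `∞`. -/
def LoopState.pruned {k : ℕ} (s : LoopState G k) (i : Fin k) (e : G.Edge) : ℕ∞ :=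
  if e.src ∈ s.reg' ∧ e.dst ∈ s.reg \ s.reg' then ⊤ else (s.tmpl i).act e

/-- The body of the main loop: prune, recompute from the pruned activation values, intersect. -/
def LoopState.body {k : ℕ} (w : Fin k → V × V → ℤ) (W : ℕ) (s : LoopState G k) :
    LoopState G k where
  reg := s.reg'
  reg' := ⋂ i, (computeQaSTel G (w i) W (s.pruned i)).1
  tmpl i := (computeQaSTel G (w i) W (s.pruned i)).2

/-- `π` is returned by `CombineQaSTel(G, {MP(w_i)})`: the main loop is left after `j` rounds, when
`𝒲 = 𝒲'` for the first time, and `π` combines strategies extracted from the final templates. -/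
def CombineReturns {k : ℕ} [NeZero k] (w : Fin k → V × V → ℤ) (W : ℕ) (π : G.Strategy) : Prop :=
  ∃ j : ℕ,
    (∀ j' < j, ((LoopState.body w W)^[j'] (loopStart G w W)).reg ≠
      ((LoopState.body w W)^[j'] (loopStart G w W)).reg') ∧
    ((LoopState.body w W)^[j] (loopStart G w W)).reg =
      ((LoopState.body w W)^[j] (loopStart G w W)).reg' ∧
    ∃ πs : Fin k → G.Positional,
      (∀ i, IsExtracted (((LoopState.body w W)^[j] (loopStart G w W)).tmpl i) (πs i)) ∧
      π = combineStrat w πs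

end Synthesis

/-! ### Step-counted programs -/

/-- A program with memory `σ` and result type `α`. `p.run b s` executes `p` from memory `s` for at
most `b` steps; it is `none` if `p` has not halted by then, and otherwise it gives the result, the
final memory and the number of steps that are left. -/
structure Timed (σ α : Type) where
  run : ℕ → σ → Option (α × σ × ℕ)

namespace Timed

variable {σ α ι : Type}

instance : Monad (Timed σ) where
  pure a := ⟨fun b s => some (a, s, b)⟩
  bind p q := ⟨fun b s => (p.run b s).bind fun r => (q r.1).run r.2.2 r.2.1⟩

/-- One step: it is used below only for a single access to a memory cell. Arithmetic and branching on
a bounded number of fetched values are counted with the access. -/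
def step (f : σ → α × σ) : Timed σ α :=
  ⟨fun b s => match b with
    | 0 => none
    | b + 1 => some ((f s).1, (f s).2, b)⟩

/-- A read access. -/
def read (f : σ → α) : Timed σ α := step fun s => (f s, s)

/-- A write access. -/
def write (f : σ → σ) : Timed σ Unit := step fun s => ((), f s)

/-- One step that leaves the memory unchanged (a loop test). -/
def tick : Timed σ Unit := step fun s => ((), s)

/-- `for a in l do body a`; every loop test is one step. -/
def forEach : List ι → (ι → Timed σ Unit) → Timed σ Unit
  | [], _ => tick
  | a :: l, body => do tick; body a; forEach l body

/-- At most `f` passes of `body`, as long as it returns `true`. -/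
def loopFuel (body : Timed σ Bool) : ℕ → Timed σ Unit
  | 0 => ⟨fun _ _ => none⟩
  | f + 1 => do
    tick
    let again ← body
    if again then loopFuel body f else pure ()

/-- Repeat `body` as long as it returns `true`. Each pass costs a step of its own, so that `b` steps
never suffice for more than `b` passes. -/
def loop (body : Timed σ Bool) : Timed σ Unit := ⟨fun b s => (loopFuel body (b + 1)).run b s⟩

end Timed

/-! ### Implementation of `CombineQaSTel` with a step count -/

/-- The memory of the implementation. -/
structure Memory {V : Type} (G : GameGraph V) (k : ℕ) where
  /-- activation value of an edge, for each objective -/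
  act : Fin k → G.Edge → ℕ∞
  /-- minimum (Player 0) or maximum (Player 1) of the activation values of the outgoing edges -/
  val : Fin k → V → ℕ∞
  /-- number of outgoing edges of a Player-0 node whose activation value equals `val` -/
  cnt : Fin k → V → ℕ
  /-- stack of nodes whose incoming edges have to be re-examined -/
  work : List V
  /-- the regions `𝒲_i` -/
  wreg : Fin k → V → Bool
  /-- the region `𝒲` -/
  cur : V → Bool
  /-- the region `𝒲'` -/
  nxt : V → Bool
  /-- result of the comparison of `𝒲` and `𝒲'` -/
  flag : Bool
  /-- the extracted edges -/
  choice : Fin k → V → Option G.Edge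

namespace Memory

variable {V : Type} [DecidableEq V] {G : GameGraph V} {k : ℕ}

def setAct (i : Fin k) (e : G.Edge) (x : ℕ∞) : Timed (Memory G k) Unit :=
  .write fun m => { m with act := Function.update m.act i (Function.update (m.act i) e x) }

def setVal (i : Fin k) (v : V) (x : ℕ∞) : Timed (Memory G k) Unit :=
  .write fun m => { m with val := Function.update m.val i (Function.update (m.val i) v x) }

def setCnt (i : Fin k) (v : V) (x : ℕ) : Timed (Memory G k) Unit :=
  .write fun m => { m with cnt := Function.update m.cnt i (Function.update (m.cnt i) v x) }

def setWreg (i : Fin k) (v : V) (x : Bool) : Timed (Memory G k) Unit :=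
  .write fun m => { m with wreg := Function.update m.wreg i (Function.update (m.wreg i) v x) }

def setCur (v : V) (x : Bool) : Timed (Memory G k) Unit :=
  .write fun m => { m with cur := Function.update m.cur v x }

def setNxt (v : V) (x : Bool) : Timed (Memory G k) Unit :=
  .write fun m => { m with nxt := Function.update m.nxt v x }

def setFlag (x : Bool) : Timed (Memory G k) Unit :=
  .write fun m => { m with flag := x }

def setChoice (i : Fin k) (v : V) (x : Option G.Edge) : Timed (Memory G k) Unit :=
  .write fun m => { m with choice := Function.update m.choice i (Function.update (m.choice i) v x) }

def clearWork : Timed (Memory G k) Unit :=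
  .write fun m => { m with work := [] }

def pushWork (v : V) : Timed (Memory G k) Unit :=
  .write fun m => { m with work := v :: m.work }

def popWork : Timed (Memory G k) (Option V) :=
  .step fun m => (m.work.head?, { m with work := m.work.tail })

end Memory

namespace Impl

open Timed Memory

/- The game graph is given by lists of its nodes, of its edges, and of the outgoing and the incoming
edges of every node. -/

variable {V : Type} [Fintype V] [DecidableEq V] (G : GameGraph V) {k : ℕ}

/-- Recompute `val` (and `cnt`) at the node `u`. -/
def refresh (i : Fin k) (u : V) : Timed (Memory G k) Unit :=
  if u ∈ G.V0 then do
    setVal i u ⊤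
    setCnt i u 0
    forEach (G.outEdges u).toList fun e => do
      let a ← read fun m => m.act i e
      let x ← read fun m => m.val i u
      if a < x then do
        setVal i u a
        setCnt i u 1
      else if a = x then do
        let c ← read fun m => m.cnt i u
        setCnt i u (c + 1)
      else pure ()
  else do
    setVal i u 0
    forEach (G.outEdges u).toList fun e => do
      let a ← read fun m => m.act i e
      let x ← read fun m => m.val i u
      if x < a then setVal i u a else pure ()

/-- The activation value of an outgoing edge of `u` has been raised from `a` to `b`. -/
def notify (i : Fin k) (u : V) (a b : ℕ∞) : Timed (Memory G k) Unit := do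
  let x ← read fun m => m.val i u
  if u ∈ G.V0 then
    if a = x then do
      let c ← read fun m => m.cnt i u
      setCnt i u (c - 1)
      if c - 1 = 0 then do
        refresh G i u
        pushWork u
      else pure ()
    else pure ()
  else
    if x < b then do
      setVal i u b
      pushWork u
    else pure ()

/-- Value iteration for the objective `i` with a work list, started from the stored activation
values; it overwrites them by the fixed point. -/
def fixPoint (w : Fin k → V × V → ℤ) (W : ℕ) (i : Fin k) : Timed (Memory G k) Unit := do
  clearWork
  forEach (Finset.univ : Finset V).toList fun v => do
    refresh G i v
    pushWork v
  loop do
    let r ← popWork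
    match r with
    | none => pure false
    | some v => do
      forEach (G.inEdges v).toList fun e => do
        let a ← read fun m => m.act i e
        let x ← read fun m => m.val i v
        let b := truncAt (Fintype.card V * W) (ominus x (w i e))
        if a < b then do
          setAct i e b
          notify G i e.src a b
        else pure ()
      pure true

/-- `computeQaSTel` for the objective `i`, hot-started from the stored activation values. -/
def compute (w : Fin k → V × V → ℤ) (W : ℕ) (i : Fin k) : Timed (Memory G k) Unit := do
  fixPoint G w W i
  forEach (Finset.univ : Finset V).toList fun v => do
    let x ← read fun m => m.val i v
    setWreg i v (decide (x ≠ ⊤))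

/-- `𝒲' ← ⋂ 𝒲_i`. -/
def intersect : Timed (Memory G k) Unit :=
  forEach (Finset.univ : Finset V).toList fun v => do
    setNxt v true
    forEach (List.finRange k) fun i => do
      let r ← read fun m => m.wreg i v
      if r then pure () else setNxt v false

/-- Is `𝒲 ≠ 𝒲'`? -/
def regionsDiffer : Timed (Memory G k) Bool := do
  setFlag false
  forEach (Finset.univ : Finset V).toList fun v => do
    let a ← read fun m => m.cur v
    let b ← read fun m => m.nxt v
    if a = b then pure () else setFlag true
  read fun m => m.flag

/-- Set all edges from `𝒲'` to `𝒲 \ 𝒲'` to `∞`. -/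
def prune : Timed (Memory G k) Unit :=
  forEach (Finset.univ : Finset G.Edge).toList fun e => do
    let a ← read fun m => m.nxt e.src
    let b ← read fun m => m.cur e.dst
    let c ← read fun m => m.nxt e.dst
    if a && b && !c then
      forEach (List.finRange k) fun i => setAct i e ⊤
    else pure ()

/-- `ExtractStrat` for the objective `i`: an edge with the smallest activation value at every
Player-0 node. -/
def extract (i : Fin k) : Timed (Memory G k) Unit :=
  forEach (Finset.univ : Finset V).toList fun v =>
    if v ∈ G.V0 then do
      setChoice i v none
      forEach (G.outEdges v).toList fun e => do
        let c ← read fun m => m.choice i v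
        match c with
        | none => setChoice i v (some e)
        | some e' => do
          let a ← read fun m => m.act i e
          let a' ← read fun m => m.act i e'
          if a < a' then setChoice i v (some e) else pure ()
    else pure ()

/-- The procedure `CombineQaSTel`. The strategy that it returns is given by the edges that are left
in `choice`. -/
def combineQaSTel (w : Fin k → V × V → ℤ) (W : ℕ) : Timed (Memory G k) Unit := do
  forEach (Finset.univ : Finset V).toList fun v => setCur v true
  forEach (List.finRange k) fun i =>
    forEach (Finset.univ : Finset G.Edge).toList fun e => setAct i e 0
  forEach (List.finRange k) fun i => compute G w W i
  intersect G
  loop do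
    let d ← regionsDiffer G
    if d then do
      prune G
      forEach (List.finRange k) fun i => compute G w W i
      forEach (Finset.univ : Finset V).toList fun v => do
        let a ← read fun m => m.nxt v
        setCur v a
      intersect G
      pure true
    else pure false
  forEach (List.finRange k) fun i => extract G i

end Impl

end

/-! Correctness rests on potentials (`IsPotential`): credits on a set `S` of nodes with which Player
0 can keep the energy non-negative forever without leaving `S`.

Nothing winning is lost. The conjunction is closed under dropping the first move, so its winning
region `S` is a set in which Player 0 can always stay and which Player 1 cannot leave. For each
weight function `S` carries a potential (`exists_isPotential_winRegion`): if the credits needed for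
longer and longer horizons were unbounded at some node of `S`, Player 1 could exhaust one finite
credit after another against a winning strategy of Player 0 and push the average below a negative
constant. By a gap argument the potential can be taken at most `(|V| - 1) · W`
(`IsPotential.exists_bounded`), so the cut-off `|V| · W` does not touch it. The edge function of
this potential is stable under value iteration and `∞` on edges that are not inside `S`. Hence it
bounds all computed activation values, pruned ones included (`subset_reg'_loopIter`), and `S` lies
in every region `𝒲'`.

Nothing else is kept. When `𝒲 = 𝒲'`, every edge leaving this set has value `∞` for every objective,
while its nodes have finite values; by stability these values are again potentials, and edges of
smallest value follow them. Thus all extracted strategies stay in the set, and while `π_i` is played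
the weight for `i` is bounded below, so each phase ends (`exists_phase_end`). Every objective is
served in infinitely many phases, with tolerances tending to zero, which yields all the mean
payoffs.

The running time is amortised. An activation or node value can rise at most `|V| · W + 1` times, and
`potential` prepays each rise, including the treatment of a node that re-enters the work list.
Values never fall, not even between rounds, because every computation starts from the pruned old
values. One budget of order `|E| · |V| · W` per objective therefore covers all value iterations
together. What remains costs `O(k · |E|)` per round, and there are at most `|V|` rounds since `𝒲`
shrinks strictly. -/

noncomputable section

set_option linter.unusedSectionVars false

/-! ### Reasoning about step-counted programs -/

namespace Timed

variable {σ α β ι : Type}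

/-- Run from memory `s` with budget `n`, the program halts, and its result, the final memory and the
budget that is left satisfy `Q`. -/
def Ok (p : Timed σ α) (n : ℕ) (s : σ) (Q : α → σ → ℕ → Prop) : Prop :=
  ∃ a s' n', p.run n s = some (a, s', n') ∧ n' ≤ n ∧ Q a s' n'

theorem Ok.mono {p : Timed σ α} {n : ℕ} {s : σ} {Q Q' : α → σ → ℕ → Prop} (h : p.Ok n s Q)
    (hQ : ∀ a s' n', Q a s' n' → Q' a s' n') : p.Ok n s Q' := by
  obtain ⟨a, s', n', h₁, h₂, h₃⟩ := h
  exact ⟨a, s', n', h₁, h₂, hQ _ _ _ h₃⟩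

theorem Ok.pure {a : α} {n : ℕ} {s : σ} {Q : α → σ → ℕ → Prop} (h : Q a s n) :
    (Pure.pure a : Timed σ α).Ok n s Q :=
  ⟨a, s, n, rfl, le_rfl, h⟩

theorem Ok.bind {p : Timed σ α} {q : α → Timed σ β} {n : ℕ} {s : σ} {Q : β → σ → ℕ → Prop}
    (h : p.Ok n s fun a s' n' => (q a).Ok n' s' Q) : (p >>= q).Ok n s Q := by
  obtain ⟨a, s', n', h₁, h₂, b, s'', n'', h₃, h₄, h₅⟩ := h
  refine ⟨b, s'', n'', ?_, h₄.trans h₂, h₅⟩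
  change (p.run n s).bind _ = _
  rw [h₁]
  exact h₃

theorem Ok.step {f : σ → α × σ} {n : ℕ} {s : σ} {Q : α → σ → ℕ → Prop} (hn : 1 ≤ n)
    (h : Q (f s).1 (f s).2 (n - 1)) : (step f).Ok n s Q := by
  obtain ⟨n, rfl⟩ := Nat.exists_eq_add_of_le' hn
  exact ⟨_, _, n, rfl, by omega, h⟩

theorem Ok.read {f : σ → α} {n : ℕ} {s : σ} {Q : α → σ → ℕ → Prop} (hn : 1 ≤ n)
    (h : Q (f s) s (n - 1)) : (read f).Ok n s Q :=
  Ok.step hn h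

theorem Ok.write {f : σ → σ} {n : ℕ} {s : σ} {Q : Unit → σ → ℕ → Prop} (hn : 1 ≤ n)
    (h : Q () (f s) (n - 1)) : (write f).Ok n s Q :=
  Ok.step hn h

theorem Ok.tick {n : ℕ} {s : σ} {Q : Unit → σ → ℕ → Prop} (hn : 1 ≤ n) (h : Q () s (n - 1)) :
    (tick : Timed σ Unit).Ok n s Q :=
  Ok.step hn h

/-- The rule for `forEach`: the invariant `I` speaks about the items that are still to be treated. -/
theorem Ok.forEach {body : ι → Timed σ Unit} {Q : Unit → σ → ℕ → Prop}
    (I : List ι → σ → ℕ → Prop)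
    (hnil : ∀ s n, I [] s n → 1 ≤ n ∧ Q () s (n - 1))
    (hcons : ∀ a l s n, I (a :: l) s n → 1 ≤ n ∧ (body a).Ok (n - 1) s fun _ => I l)
    {l : List ι} {n : ℕ} {s : σ} (h : I l s n) : (forEach l body).Ok n s Q := by
  induction l generalizing n s with
  | nil => exact Ok.tick (hnil s n h).1 (hnil s n h).2
  | cons a l ih =>
    obtain ⟨h₁, h₂⟩ := hcons a l s n h
    exact Ok.bind (Ok.tick h₁ (Ok.bind (h₂.mono fun _ s' n' h' => ih h')))

/-- Each pass spends at least one unit of budget and exactly one unit of fuel, so fuel that exceeds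
the budget never runs out. -/
theorem Ok.loopFuel {body : Timed σ Bool} {Q : Unit → σ → ℕ → Prop} (I : σ → ℕ → Prop)
    (hbody : ∀ s n, I s n → 1 ≤ n ∧
      body.Ok (n - 1) s fun again s' n' => if again then I s' n' else Q () s' n')
    {f n : ℕ} {s : σ} (hf : n < f) (h : I s n) : (loopFuel body f).Ok n s Q := by
  induction f generalizing n s with
  | zero => omega
  | succ f ih =>
    obtain ⟨h₁, a, s', n', h₂, h₃, h₄⟩ := hbody s n h
    refine Ok.bind (Ok.tick h₁ (Ok.bind ⟨a, s', n', h₂, h₃, ?_⟩))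
    cases a with
    | true => exact ih (by omega) h₄
    | false => exact Ok.pure h₄

theorem Ok.loop {body : Timed σ Bool} {Q : Unit → σ → ℕ → Prop} (I : σ → ℕ → Prop)
    (hbody : ∀ s n, I s n → 1 ≤ n ∧
      body.Ok (n - 1) s fun again s' n' => if again then I s' n' else Q () s' n')
    {n : ℕ} {s : σ} (h : I s n) : (loop body).Ok n s Q :=
  Ok.loopFuel I hbody (Nat.lt_succ_self n) h

end Timed

/-! ### Truncated subtraction and cut-off on `ℕ∞` -/

theorem ominus_top (w : ℤ) : ominus ⊤ w = ⊤ := rfl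

theorem ominus_coe (l : ℕ) (w : ℤ) : ominus (l : ℕ∞) w = (((l : ℤ) - w).toNat : ℕ∞) := rfl

theorem ominus_mono {x y : ℕ∞} (h : x ≤ y) (w : ℤ) : ominus x w ≤ ominus y w := by
  induction y using ENat.recTopCoe with
  | top => exact le_top
  | coe y =>
    induction x using ENat.recTopCoe with
    | top => exact absurd h (by simp)
    | coe x =>
      rw [ominus_coe, ominus_coe]
      have : x ≤ y := by exact_mod_cast h
      exact_mod_cast (by omega : ((x : ℤ) - w).toNat ≤ ((y : ℤ) - w).toNat)

theorem ominus_le_coe {x : ℕ∞} {w : ℤ} {c : ℕ} :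
    ominus x w ≤ c ↔ ∃ l : ℕ, x = l ∧ (l : ℤ) - w ≤ c := by
  induction x using ENat.recTopCoe with
  | top => simp [ominus_top]
  | coe x =>
    rw [ominus_coe]
    constructor
    · intro h
      have : ((x : ℤ) - w).toNat ≤ c := by exact_mod_cast h
      exact ⟨x, rfl, by omega⟩
    · rintro ⟨l, hl, h⟩
      have : x = l := by exact_mod_cast hl
      subst this
      exact_mod_cast (by omega : ((x : ℤ) - w).toNat ≤ c)

theorem truncAt_mono (B : ℕ) : Monotone (truncAt B) := by
  intro x y h
  unfold truncAt
  split_ifs with h₁ h₂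
  · exact h
  · exact le_top
  · exact absurd (h.trans ‹_›) h₁
  · exact le_rfl

theorem le_truncAt (B : ℕ) (x : ℕ∞) : x ≤ truncAt B x := by
  unfold truncAt
  split_ifs
  exacts [le_rfl, le_top]

theorem truncAt_of_le {B : ℕ} {x : ℕ∞} (h : x ≤ B) : truncAt B x = x := if_pos h

/-- The values of a value iteration with cut-off `B`. -/
def IsCutValue (B : ℕ) (x : ℕ∞) : Prop := x ≤ B ∨ x = ⊤

theorem isCutValue_truncAt (B : ℕ) (x : ℕ∞) : IsCutValue B (truncAt B x) := by
  unfold truncAt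
  split_ifs with h
  exacts [.inl h, .inr rfl]

theorem finite_setOf_isCutValue (B : ℕ) : {x | IsCutValue B x}.Finite := by
  refine (((Set.finite_Iic B).image ((↑) : ℕ → ℕ∞)).union (Set.finite_singleton ⊤)).subset ?_
  rintro x (h | h)
  · obtain ⟨n, rfl⟩ := ENat.ne_top_iff_exists.1 (h.trans_lt (ENat.natCast_lt_top B)).ne
    exact .inl ⟨n, by exact_mod_cast h, rfl⟩
  · exact .inr h

/-- The number of values above `x` in a value iteration with cut-off `B`. -/
def slack (B : ℕ) : ℕ∞ → ℕ
  | ⊤ => 0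
  | (l : ℕ) => B + 1 - l

theorem slack_le (B : ℕ) (x : ℕ∞) : slack B x ≤ B + 1 := by
  induction x using ENat.recTopCoe with
  | top => exact Nat.zero_le _
  | coe x => exact Nat.sub_le _ _

theorem slack_anti (B : ℕ) : Antitone (slack B) := by
  intro x y h
  induction y using ENat.recTopCoe with
  | top => exact Nat.zero_le _
  | coe y =>
    induction x using ENat.recTopCoe with
    | top => exact absurd h (by simp)
    | coe x =>
      have : x ≤ y := by exact_mod_cast h
      change B + 1 - y ≤ B + 1 - x
      omega

/-- Cut values matter here: a finite `x` above `B` would have slack `0` already, and raising it to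
`⊤` would gain nothing. -/
theorem slack_lt_slack {B : ℕ} {x y : ℕ∞} (hx : IsCutValue B x) (hy : IsCutValue B y)
    (h : x < y) : slack B y < slack B x := by
  induction x using ENat.recTopCoe with
  | top => exact absurd h (by simp)
  | coe x =>
    have hxB : x ≤ B := by
      rcases hx with hx | hx
      · exact_mod_cast hx
      · exact absurd hx (ENat.natCast_ne_top x)
    induction y using ENat.recTopCoe with
    | top =>
      change 0 < B + 1 - x
      omega
    | coe y =>
      have : x < y := by exact_mod_cast h
      change B + 1 - y < B + 1 - x
      omega

/-! ### Value iteration -/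

section ValueIteration

variable {V : Type} [Fintype V] [DecidableEq V] {G : GameGraph V}

theorem GameGraph.mem_outEdges {v : V} {e : G.Edge} : e ∈ G.outEdges v ↔ e.src = v := by
  simp [GameGraph.outEdges]

theorem GameGraph.mem_inEdges {v : V} {e : G.Edge} : e ∈ G.inEdges v ↔ e.dst = v := by
  simp [GameGraph.inEdges]

theorem GameGraph.outEdges_nonempty (hG : ∀ v : V, ∃ v', (v, v') ∈ G.E) (v : V) :
    (G.outEdges v).Nonempty := by
  obtain ⟨v', h⟩ := hG v
  exact ⟨⟨(v, v'), h⟩, GameGraph.mem_outEdges.2 rfl⟩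

variable (G) in
/-- The value of a node: the smallest (Player 0) or largest (Player 1) value of its outgoing
edges. -/
def nodeVal (μ : G.Edge → ℕ∞) (v : V) : ℕ∞ :=
  if v ∈ G.V0 then (G.outEdges v).inf μ else (G.outEdges v).sup μ

theorem nodeVal_mono {μ ν : G.Edge → ℕ∞} (h : μ ≤ ν) (v : V) :
    nodeVal G μ v ≤ nodeVal G ν v := by
  unfold nodeVal
  split_ifs
  · exact Finset.inf_mono_fun fun e _ => h e
  · exact Finset.sup_mono_fun fun e _ => h e

theorem isCutValue_nodeVal {B : ℕ} {μ : G.Edge → ℕ∞} (h : ∀ e, IsCutValue B (μ e)) (v : V) :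
    IsCutValue B (nodeVal G μ v) := by
  unfold nodeVal
  split_ifs
  · refine Finset.inf_induction (.inr rfl) (fun x hx y hy => ?_) fun e _ => h e
    rcases le_total x y with hxy | hxy
    · rwa [inf_eq_left.2 hxy]
    · rwa [inf_eq_right.2 hxy]
  · refine Finset.sup_induction (.inl bot_le) (fun x hx y hy => ?_) fun e _ => h e
    rcases le_total x y with hxy | hxy
    · rwa [sup_eq_right.2 hxy]
    · rwa [sup_eq_left.2 hxy]

/-- A monotone map on a linear order commutes with minima and maxima of non-empty finite sets.
Non-emptiness is essential for Player 1, since an empty maximum is `0` and `0 ⊖ w` need not be. -/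
theorem edgeOp_eq (hG : ∀ v : V, ∃ v', (v, v') ∈ G.E) (w : V × V → ℤ) (μ : G.Edge → ℕ∞)
    (e : G.Edge) : edgeOp G w μ e = ominus (nodeVal G μ e.dst) (w e) := by
  have hne := G.outEdges_nonempty hG e.dst
  have hm : Monotone fun x => ominus x (w e) := fun x y h => ominus_mono h _
  unfold edgeOp nodeVal
  split_ifs
  · rw [← Finset.inf_eq_iInf, ← Finset.inf'_eq_inf hne, ← Finset.inf'_eq_inf hne]
    exact (Finset.apply_inf'_eq_inf'_comp hne (fun x => ominus x (w e)) fun x y => hm.map_inf x y).symm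
  · rw [← Finset.sup_eq_iSup, ← Finset.sup'_eq_sup hne, ← Finset.sup'_eq_sup hne]
    exact (Finset.apply_sup'_eq_sup'_comp hne (fun x => ominus x (w e)) fun x y => hm.map_sup x y).symm

theorem mem_regionOf {μ : G.Edge → ℕ∞} {v : V} :
    v ∈ regionOf G μ ↔ nodeVal G μ v ≠ ⊤ := by
  unfold regionOf nodeVal
  by_cases hv : v ∈ G.V0
  · simp [hv, Finset.inf_eq_top_iff]
  · have : (⊥ : ℕ∞) < ⊤ := by simp
    simp [hv, ← lt_top_iff_ne_top, Finset.sup_lt_iff this]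

theorem regionOf_anti {μ ν : G.Edge → ℕ∞} (h : μ ≤ ν) :
    regionOf G ν ⊆ regionOf G μ := by
  intro v hv
  rw [mem_regionOf] at hv ⊢
  exact fun h' => hv (top_le_iff.1 (h' ▸ nodeVal_mono h v))

theorem liftOp_mono (hG : ∀ v : V, ∃ v', (v, v') ∈ G.E) (w : V × V → ℤ) (W : ℕ) :
    Monotone (liftOp G w W) := by
  intro μ ν h e
  unfold liftOp
  rw [edgeOp_eq hG, edgeOp_eq hG]
  exact max_le_max (h e) (truncAt_mono _ (ominus_mono (nodeVal_mono h _) _))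

theorem le_fixPoint (w : V × V → ℤ) (W : ℕ) (μ : G.Edge → ℕ∞) : μ ≤ fixPoint G w W μ :=
  fun e => le_iSup (fun t => (liftOp G w W)^[t] μ e) 0

/-- No further raise is possible at `μ`. -/
def IsStable (w : V × V → ℤ) (W : ℕ) (μ : G.Edge → ℕ∞) : Prop :=
  ∀ e : G.Edge, truncAt (Fintype.card V * W) (ominus (nodeVal G μ e.dst) (w e)) ≤ μ e

/-- The least-fixed-point principle. It bounds values from above in both places where this is
needed: by the edge function of a potential, and by the function left by the work list. -/
theorem fixPoint_le (hG : ∀ v : V, ∃ v', (v, v') ∈ G.E) {w : V × V → ℤ} {W : ℕ}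
    {μ ν : G.Edge → ℕ∞} (h : μ ≤ ν) (hν : IsStable w W ν) : fixPoint G w W μ ≤ ν := by
  refine fun e => iSup_le fun t => ?_
  suffices h' : (liftOp G w W)^[t] μ ≤ ν from h' e
  induction t with
  | zero => exact h
  | succ t ih =>
    rw [Function.iterate_succ_apply']
    refine (liftOp_mono hG w W ih).trans fun e => ?_
    unfold liftOp
    rw [edgeOp_eq hG]
    exact max_le le_rfl (hν e)

theorem isCutValue_liftOp {w : V × V → ℤ} {W : ℕ} {μ : G.Edge → ℕ∞}
    (h : ∀ e, IsCutValue (Fintype.card V * W) (μ e)) (e : G.Edge) :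
    IsCutValue (Fintype.card V * W) (liftOp G w W μ e) := by
  unfold liftOp
  rcases max_choice (μ e) (truncAt (Fintype.card V * W) (edgeOp G w μ e)) with h' | h' <;> rw [h']
  exacts [h e, isCutValue_truncAt _ _]

/-- All iterates take values in a finite set of cut values, so the increasing sequence becomes
stationary. -/
theorem exists_fixPoint_eq_iterate {w : V × V → ℤ} {W : ℕ} {μ : G.Edge → ℕ∞}
    (h : ∀ e, IsCutValue (Fintype.card V * W) (μ e)) :
    ∃ t, fixPoint G w W μ = (liftOp G w W)^[t] μ ∧
      liftOp G w W ((liftOp G w W)^[t] μ) = (liftOp G w W)^[t] μ := by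
  have hcut : ∀ t e, IsCutValue (Fintype.card V * W) ((liftOp G w W)^[t] μ e) := by
    intro t
    induction t with
    | zero => exact h
    | succ t ih =>
      rw [Function.iterate_succ_apply']
      exact isCutValue_liftOp ih
  have : Finite {x | IsCutValue (Fintype.card V * W) x} := finite_setOf_isCutValue _
  have hmono : Monotone fun t => (liftOp G w W)^[t] μ := by
    refine monotone_nat_of_le_succ fun t => ?_
    rw [Function.iterate_succ_apply']
    exact fun e => le_max_left _ _
  let a : ℕ →o (G.Edge → {x | IsCutValue (Fintype.card V * W) x}) :=
    ⟨fun t e => ⟨(liftOp G w W)^[t] μ e, hcut t e⟩, fun s t hst e => hmono hst e⟩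
  obtain ⟨t, ht⟩ := WellFoundedGT.monotone_chain_condition a
  have ht' : ∀ m, t ≤ m → (liftOp G w W)^[m] μ = (liftOp G w W)^[t] μ := fun m hm =>
    funext fun e => (congrArg Subtype.val (congrFun (ht m hm) e)).symm
  refine ⟨t, funext fun e => le_antisymm (iSup_le fun m => ?_) ?_, ?_⟩
  · rcases le_total m t with hm | hm
    · exact hmono hm e
    · rw [ht' m hm]
  · exact le_iSup (fun t => (liftOp G w W)^[t] μ e) t
  · exact (Function.iterate_succ_apply' _ _ _).symm.trans <| ht' _ (Nat.le_succ t)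

theorem isStable_fixPoint (hG : ∀ v : V, ∃ v', (v, v') ∈ G.E) {w : V × V → ℤ} {W : ℕ}
    {μ : G.Edge → ℕ∞} (h : ∀ e, IsCutValue (Fintype.card V * W) (μ e)) :
    IsStable w W (fixPoint G w W μ) := by
  obtain ⟨t, h₁, h₂⟩ := exists_fixPoint_eq_iterate (w := w) h
  intro e
  rw [h₁]
  conv_rhs => rw [← h₂]
  unfold liftOp
  rw [edgeOp_eq hG]
  exact le_max_right _ _

theorem isCutValue_fixPoint {w : V × V → ℤ} {W : ℕ} {μ : G.Edge → ℕ∞}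
    (h : ∀ e, IsCutValue (Fintype.card V * W) (μ e)) (e : G.Edge) :
    IsCutValue (Fintype.card V * W) (fixPoint G w W μ e) := by
  obtain ⟨t, h₁, h₂⟩ := exists_fixPoint_eq_iterate (w := w) h
  rw [h₁]
  clear h₁ h₂
  induction t generalizing e with
  | zero => exact h e
  | succ t ih =>
    rw [Function.iterate_succ_apply']
    exact isCutValue_liftOp ih e

/-- Activation values of a computed template are the fixed point itself, so a hot start continues
from the stored values. -/
theorem act_ofEdgeFun (μ : G.Edge → ℕ∞) : (QaSTel.ofEdgeFun μ).act = μ := by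
  funext e
  refine le_antisymm (sInf_le fun c hc => ⟨rfl, hc⟩) (le_sInf fun c hc => (hc c le_rfl).2)

end ValueIteration

/-! ### Correctness and cost of the work list -/

section Potential

variable {V : Type} [Fintype V] [DecidableEq V] {G : GameGraph V}

variable (G) in
/-- The cost of a change of the value of `u`. -/
def nodeCost (u : V) : ℕ := 5 * (G.outEdges u).card + 3 * (G.inEdges u).card + 7

variable (G) in
/-- The budget for all raises of values from `μ` on. -/
def potential (B : ℕ) (μ : G.Edge → ℕ∞) : ℕ :=
  ∑ u, nodeCost G u * slack B (nodeVal G μ u) + ∑ e, 4 * slack B (μ e)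

theorem Finset.sum_add_le_sum_of_mem {ι : Type*} {s : Finset ι} {f g : ι → ℕ} {a : ι} {c : ℕ}
    (ha : a ∈ s) (hfg : ∀ x ∈ s, f x ≤ g x) (hac : f a + c ≤ g a) :
    ∑ x ∈ s, f x + c ≤ ∑ x ∈ s, g x := by
  classical
  rw [← Finset.add_sum_erase s f ha, ← Finset.add_sum_erase s g ha]
  have := Finset.sum_le_sum (s := s.erase a) fun x hx => hfg x (Finset.mem_of_mem_erase hx)
  omega

/-- Raises made without payment, such as pruning, can only lower the budget that has to be reserved.
-/
theorem potential_anti (B : ℕ) : Antitone (potential G B) := fun _ _ h =>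
  Nat.add_le_add
    (Finset.sum_le_sum fun _ _ => Nat.mul_le_mul_left _ (slack_anti B (nodeVal_mono h _)))
    (Finset.sum_le_sum fun _ _ => Nat.mul_le_mul_left _ (slack_anti B (h _)))

/-- The four released units pay for writing the edge value, reading the node value, and reading and
writing the counter. -/
theorem potential_add_le {B : ℕ} {μ ν : G.Edge → ℕ∞} (hμν : μ ≤ ν)
    (hμ : ∀ e, IsCutValue B (μ e)) (hν : ∀ e, IsCutValue B (ν e)) {e : G.Edge} (he : μ e < ν e) :
    potential G B ν + 4 ≤ potential G B μ := by
  have h₁ : ∑ u, nodeCost G u * slack B (nodeVal G ν u) ≤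
      ∑ u, nodeCost G u * slack B (nodeVal G μ u) :=
    Finset.sum_le_sum fun _ _ => Nat.mul_le_mul_left _ (slack_anti B (nodeVal_mono hμν _))
  have h₂ : ∑ e, 4 * slack B (ν e) + 4 ≤ ∑ e, 4 * slack B (μ e) := by
    refine Finset.sum_add_le_sum_of_mem (Finset.mem_univ e)
      (fun e _ => Nat.mul_le_mul_left _ (slack_anti B (hμν e))) ?_
    have := slack_lt_slack (hμ e) (hν e) he
    omega
  unfold potential
  omega

/-- The extra `nodeCost` pays for `refresh`, for the push and for the later treatment of `u` from
the work list. -/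
theorem potential_add_nodeCost_le {B : ℕ} {μ ν : G.Edge → ℕ∞} (hμν : μ ≤ ν)
    (hμ : ∀ e, IsCutValue B (μ e)) (hν : ∀ e, IsCutValue B (ν e)) {e : G.Edge} (he : μ e < ν e)
    {u : V} (hu : nodeVal G μ u < nodeVal G ν u) :
    potential G B ν + nodeCost G u + 4 ≤ potential G B μ := by
  have h₁ : ∑ u, nodeCost G u * slack B (nodeVal G ν u) + nodeCost G u ≤
      ∑ u, nodeCost G u * slack B (nodeVal G μ u) := by
    refine Finset.sum_add_le_sum_of_mem (Finset.mem_univ u)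
      (fun _ _ => Nat.mul_le_mul_left _ (slack_anti B (nodeVal_mono hμν _))) ?_
    rw [← Nat.mul_succ]
    exact Nat.mul_le_mul_left _
      (slack_lt_slack (isCutValue_nodeVal hμ u) (isCutValue_nodeVal hν u) hu)
  have h₂ : ∑ e, 4 * slack B (ν e) + 4 ≤ ∑ e, 4 * slack B (μ e) := by
    refine Finset.sum_add_le_sum_of_mem (Finset.mem_univ e)
      (fun e _ => Nat.mul_le_mul_left _ (slack_anti B (hμν e))) ?_
    have := slack_lt_slack (hμ e) (hν e) he
    omega
  unfold potential
  omega

variable (G) in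
theorem sum_card_outEdges : ∑ u, (G.outEdges u).card = G.E.card := by
  rw [← Fintype.card_coe G.E, ← Finset.card_univ]
  exact (Finset.card_eq_sum_card_fiberwise fun e _ => Finset.mem_coe.2 (Finset.mem_univ e.1.1)).symm

variable (G) in
theorem sum_card_inEdges : ∑ u, (G.inEdges u).card = G.E.card := by
  rw [← Fintype.card_coe G.E, ← Finset.card_univ]
  exact (Finset.card_eq_sum_card_fiberwise fun e _ => Finset.mem_coe.2 (Finset.mem_univ e.1.2)).symm

variable (G) in
theorem sum_nodeCost : ∑ u, nodeCost G u = 8 * G.E.card + 7 * Fintype.card V := by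
  simp only [nodeCost, Finset.sum_add_distrib, ← Finset.mul_sum, sum_card_outEdges,
    sum_card_inEdges, Finset.sum_const, Finset.card_univ, smul_eq_mul]
  ring

theorem potential_le (B : ℕ) (μ : G.Edge → ℕ∞) :
    potential G B μ ≤ (12 * G.E.card + 7 * Fintype.card V) * (B + 1) := by
  have h₁ : ∑ u, nodeCost G u * slack B (nodeVal G μ u) ≤
      (8 * G.E.card + 7 * Fintype.card V) * (B + 1) := by
    rw [← sum_nodeCost, Finset.sum_mul]
    exact Finset.sum_le_sum fun _ _ => Nat.mul_le_mul_left _ (slack_le _ _)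
  have h₂ : ∑ e, 4 * slack B (μ e) ≤ G.E.card * (4 * (B + 1)) := by
    rw [← Fintype.card_coe G.E, ← Finset.card_univ]
    exact Finset.sum_le_card_nsmul _ _ _ fun _ _ => Nat.mul_le_mul_left _ (slack_le _ _)
  calc potential G B μ ≤ _ := Nat.add_le_add h₁ h₂
    _ = _ := by ring

end Potential

/-! ### Effect of changing the value of a single edge -/

section NodeUpdate

variable {V : Type} [Fintype V] [DecidableEq V] {G : GameGraph V}

theorem nodeVal_update_of_ne (μ : G.Edge → ℕ∞) (e : G.Edge) (b : ℕ∞) {v : V} (hv : v ≠ e.src) :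
    nodeVal G (Function.update μ e b) v = nodeVal G μ v := by
  have : ∀ e' ∈ G.outEdges v, Function.update μ e b e' = μ e' := fun e' he' =>
    Function.update_of_ne
      (by rintro rfl; exact hv (GameGraph.mem_outEdges.1 he').symm) _ _
  unfold nodeVal
  rw [Finset.inf_congr rfl this, Finset.sup_congr rfl this]

/-- Outgoing edges of `v` of value `x`. -/
def edgesAt (μ : G.Edge → ℕ∞) (v : V) (x : ℕ∞) : Finset G.Edge :=
  (G.outEdges v).filter fun e => μ e = x

theorem edgesAt_update_of_ne (μ : G.Edge → ℕ∞) (e : G.Edge) (b x : ℕ∞) {v : V} (hv : v ≠ e.src) :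
    edgesAt (Function.update μ e b) v x = edgesAt μ v x := by
  refine Finset.filter_congr fun e' he' => ?_
  rw [Function.update_of_ne]
  rintro rfl
  exact hv (GameGraph.mem_outEdges.1 he').symm

theorem edgesAt_update (μ : G.Edge → ℕ∞) (e : G.Edge) {b x : ℕ∞} (hb : b ≠ x) (v : V) :
    edgesAt (Function.update μ e b) v x = (edgesAt μ v x).erase e := by
  ext e'
  by_cases h : e' = e
  · subst h
    simp [edgesAt, hb]
  · simp [edgesAt, h]

theorem le_update_of_le {μ : G.Edge → ℕ∞} {e : G.Edge} {b : ℕ∞} (h : μ e ≤ b) :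
    μ ≤ Function.update μ e b :=
  le_update_iff.2 ⟨h, fun _ _ => le_rfl⟩

theorem nodeVal_le_of_mem {μ : G.Edge → ℕ∞} {e : G.Edge} (h : e.src ∈ G.V0) :
    nodeVal G μ e.src ≤ μ e := by
  unfold nodeVal
  rw [if_pos h]
  exact Finset.inf_le (GameGraph.mem_outEdges.2 rfl)

theorem le_nodeVal_of_notMem {μ : G.Edge → ℕ∞} {e : G.Edge} (h : e.src ∉ G.V0) :
    μ e ≤ nodeVal G μ e.src := by
  unfold nodeVal
  rw [if_neg h]
  exact Finset.le_sup (f := μ) (GameGraph.mem_outEdges.2 rfl)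

theorem exists_eq_nodeVal (hG : ∀ v : V, ∃ v', (v, v') ∈ G.E) (μ : G.Edge → ℕ∞) (v : V) :
    ∃ e ∈ G.outEdges v, μ e = nodeVal G μ v := by
  unfold nodeVal
  split_ifs
  · obtain ⟨e, he, h⟩ := Finset.exists_mem_eq_inf _ (G.outEdges_nonempty hG v) μ
    exact ⟨e, he, h.symm⟩
  · obtain ⟨e, he, h⟩ := Finset.exists_mem_eq_sup _ (G.outEdges_nonempty hG v) μ
    exact ⟨e, he, h.symm⟩

end NodeUpdate

/-! ### Frame and consistency conditions on the memory -/

namespace Memory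

variable {V : Type} [Fintype V] [DecidableEq V] {G : GameGraph V} {k : ℕ}

/-- The memory after the value and the counter of `u` have been overwritten. -/
def withNode (m : Memory G k) (i : Fin k) (u : V) (x : ℕ∞) (c : ℕ) : Memory G k :=
  { m with
    val := Function.update m.val i (Function.update (m.val i) u x)
    cnt := Function.update m.cnt i (Function.update (m.cnt i) u c) }

theorem withNode_withNode (m : Memory G k) (i : Fin k) (u : V) (x x' : ℕ∞) (c c' : ℕ) :
    (m.withNode i u x c).withNode i u x' c' = m.withNode i u x' c' := by
  simp [withNode]

/-- `m'` differs from `m` only in data of the objective `i` and in auxiliary data. -/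
structure SameExcept (i : Fin k) (m m' : Memory G k) : Prop where
  act : ∀ j, j ≠ i → m'.act j = m.act j
  wreg : ∀ j, j ≠ i → m'.wreg j = m.wreg j
  cur : m'.cur = m.cur
  nxt : m'.nxt = m.nxt

theorem SameExcept.trans {i : Fin k} {m m' m'' : Memory G k} (h : SameExcept i m m')
    (h' : SameExcept i m' m'') : SameExcept i m m'' :=
  ⟨fun j hj => (h'.act j hj).trans (h.act j hj), fun j hj => (h'.wreg j hj).trans (h.wreg j hj),
    h'.cur.trans h.cur, h'.nxt.trans h.nxt⟩

theorem SameExcept.refl (i : Fin k) (m : Memory G k) : SameExcept i m m :=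
  ⟨fun _ _ => rfl, fun _ _ => rfl, rfl, rfl⟩

/-- The value and the counter of `u` fit the activation values of its outgoing edges. -/
def NodeOk (m : Memory G k) (i : Fin k) (u : V) : Prop :=
  m.val i u = nodeVal G (m.act i) u ∧
    (u ∈ G.V0 → m.cnt i u = (edgesAt (m.act i) u (nodeVal G (m.act i) u)).card)

end Memory

/-! ### Recomputing the value of a node -/

namespace Impl

open Timed Memory

variable {V : Type} [Fintype V] [DecidableEq V] {G : GameGraph V} {k : ℕ}

theorem ok_setVal {i : Fin k} {u : V} {x : ℕ∞} {n : ℕ} {m : Memory G k}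
    {Q : Unit → Memory G k → ℕ → Prop} (hn : 1 ≤ n)
    (h : Q () (m.withNode i u x (m.cnt i u)) (n - 1)) : (setVal i u x).Ok n m Q := by
  refine Ok.write hn ?_
  convert h using 1
  simp [withNode]

theorem ok_setCnt {i : Fin k} {u : V} {c : ℕ} {n : ℕ} {m : Memory G k}
    {Q : Unit → Memory G k → ℕ → Prop} (hn : 1 ≤ n)
    (h : Q () (m.withNode i u (m.val i u) c) (n - 1)) : (setCnt i u c).Ok n m Q := by
  refine Ok.write hn ?_
  convert h using 1
  simp [withNode]

/-- Here and below `R` is budget set aside for the rest of the program. Each edge costs at most five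
steps: the loop test, two reads and up to two further accesses. The two initial writes and the last
loop test give the constant `3`. -/
theorem ok_refresh (i : Fin k) (u : V) (m : Memory G k) {n R : ℕ}
    (hn : 5 * (G.outEdges u).card + 3 + R ≤ n) :
    (refresh G i u).Ok n m fun _ m' n' =>
      (∃ x c, m' = m.withNode i u x c) ∧ m'.NodeOk i u ∧ R ≤ n' := by
  unfold refresh
  by_cases hu : u ∈ G.V0
  · rw [if_pos hu]
    refine Ok.bind (ok_setVal (by omega) (Ok.bind (ok_setCnt (by omega) ?_)))
    -- `x` is the minimum over the scanned edges `pre`, given by its universal property so that the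
    -- empty prefix needs no special case; `c` counts how often it is attained.
    refine Ok.forEach (fun l m' n' => ∃ pre x c, pre ++ l = (G.outEdges u).toList ∧
      m' = m.withNode i u x c ∧ (∀ y, y ≤ x ↔ ∀ e ∈ pre, y ≤ m.act i e) ∧
      c = pre.countP (fun e => m.act i e = x) ∧ 5 * l.length + 1 + R ≤ n') ?_ ?_ ?_
    · rintro _ n' ⟨pre, x, c, hpre, rfl, hx, hc, hn'⟩
      rw [List.append_nil] at hpre
      have hx' : x = nodeVal G (m.act i) u := by
        unfold nodeVal
        rw [if_pos hu]
        refine le_antisymm (Finset.le_inf fun e he => (hx x).1 le_rfl e ?_)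
          ((hx _).2 fun e he => Finset.inf_le ?_)
        · rw [hpre]; exact Finset.mem_toList.2 he
        · rw [hpre] at he; exact Finset.mem_toList.1 he
      refine ⟨by omega, ⟨x, c, rfl⟩, ⟨?_, fun _ => ?_⟩, by omega⟩
      · simpa [withNode] using hx'
      · simp only [withNode, Function.update_self, ← hx']
        rw [hc, hpre, edgesAt, Finset.card_def, Finset.filter_val, ← Multiset.countP_eq_card_filter,
          ← Finset.coe_toList, Multiset.coe_countP]
    · rintro a l _ n' ⟨pre, x, c, hpre, rfl, hx, hc, hn'⟩
      rw [List.length_cons] at hn'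
      refine ⟨by omega, Ok.bind (Ok.read (by omega) (Ok.bind (Ok.read (by omega) ?_)))⟩
      have e₁ : (m.withNode i u x c).act i a = m.act i a := rfl
      have e₂ : (m.withNode i u x c).val i u = x := by simp [withNode]
      have e₃ : (m.withNode i u x c).cnt i u = c := by simp [withNode]
      rw [e₁, e₂]
      have hpre' : (pre ++ [a]) ++ l = (G.outEdges u).toList := by simpa using hpre
      rcases lt_trichotomy (m.act i a) x with h | h | h
      · rw [if_pos h]
        refine Ok.bind (ok_setVal (by omega) (ok_setCnt (by omega) ?_))
        refine ⟨pre ++ [a], m.act i a, 1, hpre', ?_, fun y => ?_, ?_, by omega⟩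
        · simp [withNode]
        · rw [List.forall_mem_append, ← hx]
          simpa using fun hy => hy.trans h.le
        -- All scanned edges have values at least `x`, which exceeds the new minimum, so counting
        -- restarts with the current edge alone.
        · have : pre.countP (fun e => m.act i e = m.act i a) = 0 := by
            rw [List.countP_eq_zero]
            intro e he
            have := (hx x).1 le_rfl e he
            simpa using (h.trans_le this).ne'
          simp [List.countP_append, this]
      · rw [if_neg h.not_lt, if_pos h]
        refine Ok.bind (Ok.read (by omega) (ok_setCnt (by omega) ?_))
        refine ⟨pre ++ [a], x, c + 1, hpre', ?_, fun y => ?_, ?_, by omega⟩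
        · rw [e₂, e₃, withNode_withNode]
        · rw [List.forall_mem_append, ← hx]
          simp [h]
        · simp [List.countP_append, h, hc]
      · rw [if_neg h.le.not_gt, if_neg h.ne']
        refine Ok.pure ⟨pre ++ [a], x, c, hpre', rfl, fun y => ?_, ?_, by omega⟩
        · rw [List.forall_mem_append, ← hx]
          simpa using fun hy => hy.trans h.le
        · simp [List.countP_append, h.ne', hc]
    · refine ⟨[], ⊤, 0, rfl, ?_, by simp, rfl, ?_⟩
      · simp [withNode]
      · rw [Finset.length_toList]; omega
  · rw [if_neg hu]
    refine Ok.bind (ok_setVal (by omega) ?_)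
    refine Ok.forEach (fun l m' n' => ∃ pre x, pre ++ l = (G.outEdges u).toList ∧
      m' = m.withNode i u x (m.cnt i u) ∧ (∀ y, x ≤ y ↔ ∀ e ∈ pre, m.act i e ≤ y) ∧
      5 * l.length + 1 + R ≤ n') ?_ ?_ ?_
    · rintro _ n' ⟨pre, x, hpre, rfl, hx, hn'⟩
      rw [List.append_nil] at hpre
      have hx' : x = nodeVal G (m.act i) u := by
        unfold nodeVal
        rw [if_neg hu]
        refine le_antisymm ((hx _).2 fun e he => Finset.le_sup (f := m.act i) ?_)
          (Finset.sup_le fun e he => (hx x).1 le_rfl e ?_)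
        · rw [hpre] at he; exact Finset.mem_toList.1 he
        · rw [hpre]; exact Finset.mem_toList.2 he
      refine ⟨by omega, ⟨x, _, rfl⟩, ⟨?_, fun h => absurd h hu⟩, by omega⟩
      simpa [withNode] using hx'
    · rintro a l _ n' ⟨pre, x, hpre, rfl, hx, hn'⟩
      rw [List.length_cons] at hn'
      refine ⟨by omega, Ok.bind (Ok.read (by omega) (Ok.bind (Ok.read (by omega) ?_)))⟩
      have e₁ : (m.withNode i u x (m.cnt i u)).act i a = m.act i a := rfl
      have e₂ : (m.withNode i u x (m.cnt i u)).val i u = x := by simp [withNode]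
      rw [e₁, e₂]
      have hpre' : (pre ++ [a]) ++ l = (G.outEdges u).toList := by simpa using hpre
      by_cases h : x < m.act i a
      · rw [if_pos h]
        refine ok_setVal (by omega) ⟨pre ++ [a], m.act i a, hpre', ?_, fun y => ?_, by omega⟩
        · simp [withNode]
        · rw [List.forall_mem_append, ← hx]
          simpa using fun hy => h.le.trans hy
      · rw [if_neg h]
        refine Ok.pure ⟨pre ++ [a], x, hpre', rfl, fun y => ?_, by omega⟩
        rw [List.forall_mem_append, ← hx]
        simpa using fun hy => (not_lt.1 h).trans hy
    · refine ⟨[], 0, rfl, rfl, by simp, ?_⟩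
      rw [Finset.length_toList]; omega

end Impl

/-! ### Raising the value of an edge -/

namespace Impl

open Timed Memory

variable {V : Type} [Fintype V] [DecidableEq V] {G : GameGraph V} {k : ℕ}

variable (G) in
/-- The cost of treating the nodes on the work list. -/
def workCost (l : List V) : ℕ := (l.map fun v => 3 * (G.inEdges v).card + 3).sum

theorem workCost_cons (v : V) (l : List V) :
    workCost G (v :: l) = 3 * (G.inEdges v).card + 3 + workCost G l := rfl

theorem nodeOk_congr {m m' : Memory G k} {i : Fin k} {u : V} (h : m.NodeOk i u)
    (hact : m'.act i = m.act i) (hval : m'.val i u = m.val i u) (hcnt : m'.cnt i u = m.cnt i u) :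
    m'.NodeOk i u := by
  unfold Memory.NodeOk
  rw [hact, hval, hcnt]
  exact h

theorem nodeOk_withNode_of_ne {m : Memory G k} {i : Fin k} {u v : V} {x : ℕ∞} {c : ℕ}
    (h : m.NodeOk i v) (hv : v ≠ u) : (m.withNode i u x c).NodeOk i v :=
  nodeOk_congr h rfl (by simp [withNode, hv]) (by simp [withNode, hv])

/-- Raising the activation value of an edge. -/
theorem ok_raise (hG : ∀ v : V, ∃ v', (v, v') ∈ G.E) {B : ℕ} (i : Fin k) (e : G.Edge) (b : ℕ∞)
    (m : Memory G k) {n R : ℕ} (hok : ∀ u, m.NodeOk i u) (hcut : ∀ e, IsCutValue B (m.act i e))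
    (hb : IsCutValue B b) (hab : m.act i e < b)
    (hn : potential G B (m.act i) + workCost G m.work + R ≤ n) :
    (setAct i e b >>= fun _ => notify G i e.src (m.act i e) b).Ok n m fun _ m' n' =>
      SameExcept i m m' ∧ m'.act i = Function.update (m.act i) e b ∧ (∀ u, m'.NodeOk i u) ∧
      (∀ v, v ∈ m.work ∨ nodeVal G (m'.act i) v ≠ nodeVal G (m.act i) v → v ∈ m'.work) ∧
      potential G B (m'.act i) + workCost G m'.work + R ≤ n' := by
  set μ := m.act i with hμ
  set ν := Function.update μ e b with hν
  have hle : μ ≤ ν := le_update_of_le hab.le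
  have hνe : ν e = b := Function.update_self ..
  have hcut' : ∀ e', IsCutValue B (ν e') := by
    intro e'
    by_cases h : e' = e
    · rw [h, hνe]; exact hb
    · rw [hν, Function.update_of_ne h]; exact hcut e'
  have hpot := potential_add_le hle hcut hcut' (e := e) (by rwa [hνe])
  have hpot' := fun u => potential_add_nodeCost_le hle hcut hcut' (e := e) (by rwa [hνe]) (u := u)
  have hother : ∀ v, v ≠ e.src → nodeVal G ν v = nodeVal G μ v := fun v hv =>
    nodeVal_update_of_ne _ _ _ hv
  refine Ok.bind (Ok.write (by omega) ?_)
  set m₁ : Memory G k := { m with act := Function.update m.act i (Function.update (m.act i) e b) }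
    with hm₁
  have hact₁ : m₁.act i = ν := by simp [hm₁, hν, hμ]
  have hsame₁ : SameExcept i m m₁ :=
    ⟨fun j hj => by simp [hm₁, hj], fun _ _ => rfl, rfl, rfl⟩
  have hok₁ : ∀ u, u ≠ e.src → m₁.NodeOk i u := by
    intro u hu
    unfold Memory.NodeOk
    rw [hact₁, hother u hu, hν, edgesAt_update_of_ne _ _ _ _ hu]
    exact hok u
  have hval₁ : m₁.val i e.src = nodeVal G μ e.src := (hok e.src).1
  unfold notify
  refine Ok.bind (Ok.read (by omega) ?_)
  rw [hval₁]
  -- the value of the source is unchanged and its counter is right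
  have hstay : ∀ m₂ : Memory G k, SameExcept i m m₂ → m₂.act i = ν → (∀ u, m₂.NodeOk i u) →
      m₂.work = m.work → nodeVal G ν e.src = nodeVal G μ e.src → ∀ n', n ≤ n' + 4 →
      SameExcept i m m₂ ∧ m₂.act i = ν ∧ (∀ u, m₂.NodeOk i u) ∧
      (∀ v, v ∈ m.work ∨ nodeVal G (m₂.act i) v ≠ nodeVal G μ v → v ∈ m₂.work) ∧
      potential G B (m₂.act i) + workCost G m₂.work + R ≤ n' := by
    intro m₂ h₁ h₂ h₃ h₄ h₅ n' h₆
    refine ⟨h₁, h₂, h₃, fun v hv => ?_, ?_⟩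
    · rw [h₄]
      refine hv.resolve_right fun h => h ?_
      rw [h₂]
      by_cases hv' : v = e.src
      · rw [hv', h₅]
      · exact hother v hv'
    · rw [h₂, h₄]
      omega
  by_cases hV : e.src ∈ G.V0
  · rw [if_pos hV]
    by_cases ha : μ e = nodeVal G μ e.src
    · rw [if_pos ha]
      refine Ok.bind (Ok.read (by omega) (Ok.bind (ok_setCnt (by omega) ?_)))
      set m₂ := m₁.withNode i e.src (m₁.val i e.src) (m₁.cnt i e.src - 1) with hm₂
      have hsame₂ : SameExcept i m m₂ :=
        hsame₁.trans ⟨fun _ _ => rfl, fun _ _ => rfl, rfl, rfl⟩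
      -- The raised edge attained the old minimum and no longer does, so decrementing the counter
      -- keeps it exact with respect to the old minimum.
      have hcard : (edgesAt ν e.src (nodeVal G μ e.src)).card = m₁.cnt i e.src - 1 := by
        rw [hν, edgesAt_update _ _ (by rw [← ha]; exact hab.ne') e.src, Finset.card_erase_of_mem]
        · rw [← (hok e.src).2 hV]
        · exact Finset.mem_filter.2 ⟨GameGraph.mem_outEdges.2 rfl, ha⟩
      by_cases hc : m₁.cnt i e.src - 1 = 0
      · rw [if_pos hc]
        -- No edge is left at the old minimum, and the minimum is attained, so it has risen
        -- strictly.
        have hlt : nodeVal G μ e.src < nodeVal G ν e.src := by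
          refine lt_of_le_of_ne (nodeVal_mono hle _) fun h => ?_
          obtain ⟨e', he', h'⟩ := exists_eq_nodeVal hG ν e.src
          rw [hc, Finset.card_eq_zero] at hcard
          have : e' ∈ edgesAt ν e.src (nodeVal G μ e.src) :=
            Finset.mem_filter.2 ⟨he', by rw [h', h]⟩
          rw [hcard] at this
          exact absurd this (Finset.notMem_empty _)
        have hp := hpot' _ hlt
        unfold nodeCost at hp
        refine Ok.bind ((ok_refresh i e.src m₂
          (R := potential G B ν + workCost G (e.src :: m.work) + R + 1) ?_).mono ?_)
        · rw [workCost_cons]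
          omega
        rintro _ m₃ n' ⟨⟨x, c, rfl⟩, hok₃, hn'⟩
        refine Ok.write (by omega) ⟨hsame₂.trans ⟨fun _ _ => rfl, fun _ _ => rfl, rfl, rfl⟩,
          hact₁, fun u => ?_, fun v hv => ?_, ?_⟩
        · by_cases hu : u = e.src
          · rw [hu]
            exact nodeOk_congr hok₃ rfl rfl rfl
          · exact nodeOk_congr (nodeOk_withNode_of_ne (nodeOk_withNode_of_ne (hok₁ u hu) hu) hu)
              rfl rfl rfl
        · by_cases hv' : v = e.src
          · rw [hv']
            exact List.mem_cons_self
          · refine List.mem_cons_of_mem _ (hv.resolve_right fun h => h ?_)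
            exact (congrArg (fun f => nodeVal G f v) hact₁).trans (hother v hv')
        · change potential G B (m₁.act i) + workCost G (e.src :: m.work) + R ≤ _
          rw [hact₁]
          omega
      · rw [if_neg hc]
        have heq : nodeVal G ν e.src = nodeVal G μ e.src := by
          refine le_antisymm ?_ (nodeVal_mono hle _)
          rw [← hcard] at hc
          obtain ⟨e', he'⟩ := Finset.card_pos.1 (Nat.pos_of_ne_zero hc)
          obtain ⟨h₁, h₂⟩ := Finset.mem_filter.1 he'
          rw [GameGraph.mem_outEdges] at h₁
          rw [← h₂, ← h₁]
          exact nodeVal_le_of_mem (h₁ ▸ hV)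
        refine Ok.pure (hstay m₂ hsame₂ hact₁ (fun u => ?_) rfl heq _ (by omega))
        by_cases hu : u = e.src
        · have ha₂ : m₂.act i = ν := hact₁
          rw [hu]
          refine ⟨?_, fun _ => ?_⟩
          · rw [ha₂, heq, ← hval₁]
            simp [hm₂, withNode]
          · rw [ha₂, heq, hcard]
            simp [hm₂, withNode]
        · exact nodeOk_withNode_of_ne (hok₁ u hu) hu
    · rw [if_neg ha]
      have hlt : nodeVal G μ e.src < μ e := lt_of_le_of_ne (nodeVal_le_of_mem hV) (Ne.symm ha)
      have hset : edgesAt ν e.src (nodeVal G μ e.src) = edgesAt μ e.src (nodeVal G μ e.src) := by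
        rw [hν, edgesAt_update _ _ (hlt.trans hab).ne', Finset.erase_eq_of_notMem]
        exact fun h => ha (Finset.mem_filter.1 h).2
      have heq : nodeVal G ν e.src = nodeVal G μ e.src := by
        refine le_antisymm ?_ (nodeVal_mono hle _)
        obtain ⟨e', he', h⟩ := exists_eq_nodeVal hG μ e.src
        have h₁ : e' ∈ edgesAt ν e.src (nodeVal G μ e.src) := by
          rw [hset]
          exact Finset.mem_filter.2 ⟨he', h⟩
        obtain ⟨h₂, h₃⟩ := Finset.mem_filter.1 h₁
        rw [GameGraph.mem_outEdges] at h₂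
        rw [← h₃, ← h₂]
        exact nodeVal_le_of_mem (h₂ ▸ hV)
      refine Ok.pure (hstay m₁ hsame₁ hact₁ (fun u => ?_) rfl heq _ (by omega))
      by_cases hu : u = e.src
      · rw [hu]
        unfold Memory.NodeOk
        rw [hact₁, heq, hset]
        exact hok e.src
      · exact hok₁ u hu
  · rw [if_neg hV]
    -- Raising one argument of a maximum needs no rescan: the new maximum is either the old one or
    -- `b`.
    have hsup : nodeVal G ν e.src = max (nodeVal G μ e.src) b := by
      refine le_antisymm ?_ (max_le (nodeVal_mono hle _) (hνe ▸ le_nodeVal_of_notMem hV))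
      obtain ⟨e', he', h⟩ := exists_eq_nodeVal hG ν e.src
      rw [← h]
      by_cases hee : e' = e
      · rw [hee, hνe]
        exact le_max_right _ _
      · rw [hν, Function.update_of_ne hee]
        rw [GameGraph.mem_outEdges] at he'
        rw [← he']
        exact le_max_of_le_left (le_nodeVal_of_notMem (he' ▸ hV))
    by_cases hx : nodeVal G μ e.src < b
    · rw [if_pos hx]
      rw [max_eq_right hx.le] at hsup
      have hp := hpot' e.src (by rwa [hsup])
      unfold nodeCost at hp
      refine Ok.bind (ok_setVal (by omega) (Ok.write (by omega)
        ⟨hsame₁.trans ⟨fun _ _ => rfl, fun _ _ => rfl, rfl, rfl⟩, hact₁, fun u => ?_, fun v hv => ?_,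
          ?_⟩))
      · by_cases hu : u = e.src
        · rw [hu]
          refine ⟨?_, fun h => absurd h hV⟩
          change (m₁.withNode i e.src b (m₁.cnt i e.src)).val i e.src = nodeVal G (m₁.act i) e.src
          rw [hact₁, hsup]
          simp [withNode]
        · exact nodeOk_congr (nodeOk_withNode_of_ne (hok₁ u hu) hu) rfl rfl rfl
      · by_cases hv' : v = e.src
        · rw [hv']
          exact List.mem_cons_self
        · refine List.mem_cons_of_mem _ (hv.resolve_right fun h => h ?_)
          exact (congrArg (fun f => nodeVal G f v) hact₁).trans (hother v hv')
      · change potential G B (m₁.act i) + workCost G (e.src :: m.work) + R ≤ _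
        rw [hact₁, workCost_cons]
        omega
    · rw [if_neg hx]
      rw [max_eq_left (not_lt.1 hx)] at hsup
      refine Ok.pure (hstay m₁ hsame₁ hact₁ (fun u => ?_) rfl hsup _ (by omega))
      by_cases hu : u = e.src
      · rw [hu]
        refine ⟨?_, fun h => absurd h hV⟩
        rw [hact₁, hsup]
        exact hval₁
      · exact hok₁ u hu

end Impl

/-! ### Value iteration with a work list -/

namespace Impl

open Timed Memory

variable {V : Type} [Fintype V] [DecidableEq V] {G : GameGraph V} {k : ℕ}

/-- The invariant of the work list. The edges in `l` lead to the node that is being treated. -/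
structure WorkInv (w : V × V → ℤ) (W : ℕ) (i : Fin k) (m₀ : Memory G k) (l : List G.Edge)
    (m : Memory G k) : Prop where
  same : SameExcept i m₀ m
  nodeOk : ∀ u, m.NodeOk i u
  cut : ∀ e, IsCutValue (Fintype.card V * W) (m.act i e)
  ge : m₀.act i ≤ m.act i
  le : m.act i ≤ _root_.fixPoint G w W (m₀.act i)
  stable : ∀ e : G.Edge, e.dst ∈ m.work ∨ e ∈ l ∨
    truncAt (Fintype.card V * W) (ominus (nodeVal G (m.act i) e.dst) (w e)) ≤ m.act i e

/-- An edge that is not raised costs three steps, which `workCost` has reserved for it; a raise is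
paid by the drop of `potential`. -/
theorem ok_treatNode (hG : ∀ v : V, ∃ v', (v, v') ∈ G.E) (w : Fin k → V × V → ℤ) (W : ℕ)
    (i : Fin k) (v : V) {m₀ m : Memory G k} {n R : ℕ}
    (hcut : ∀ e, IsCutValue (Fintype.card V * W) (m₀.act i e))
    (hI : WorkInv (w i) W i m₀ (G.inEdges v).toList m)
    (hn : potential G (Fintype.card V * W) (m.act i) + workCost G m.work
      + 3 * (G.inEdges v).card + 1 + R ≤ n) :
    (forEach (G.inEdges v).toList fun e => do
        let a ← Timed.read fun m => m.act i e
        let x ← Timed.read fun m => m.val i v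
        let b := truncAt (Fintype.card V * W) (ominus x (w i e))
        if a < b then do
          setAct i e b
          notify G i e.src a b
        else pure ()).Ok n m fun _ m' n' => WorkInv (w i) W i m₀ [] m' ∧
      potential G (Fintype.card V * W) (m'.act i) + workCost G m'.work + R ≤ n' := by
  refine Ok.forEach (fun l m' n' => (∀ e ∈ l, e.dst = v) ∧ WorkInv (w i) W i m₀ l m' ∧
    potential G (Fintype.card V * W) (m'.act i) + workCost G m'.work + 3 * l.length + 1 + R ≤ n')
    ?_ ?_ ⟨fun e he => GameGraph.mem_inEdges.1 (Finset.mem_toList.1 he), hI, ?_⟩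
  · rintro m' n' ⟨_, h, hn'⟩
    rw [List.length_nil] at hn'
    exact ⟨by omega, h, by omega⟩
  · rintro e l m' n' ⟨hl, h, hn'⟩
    rw [List.length_cons] at hn'
    have hl' : ∀ e ∈ l, e.dst = v := fun e he => hl e (List.mem_cons_of_mem _ he)
    have hev : e.dst = v := hl e List.mem_cons_self
    refine ⟨by omega, Ok.bind (Ok.read (by omega) (Ok.bind (Ok.read (by omega) ?_)))⟩
    dsimp only
    -- The value of `v` is read anew for every edge, since raising a self-loop may have changed it;
    -- `v` is then on the work list again.
    rw [(h.nodeOk v).1]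
    set b := truncAt (Fintype.card V * W) (ominus (nodeVal G (m'.act i) v) (w i e)) with hb
    by_cases hab : m'.act i e < b
    · rw [if_pos hab]
      refine (ok_raise hG i e b m' h.nodeOk h.cut (isCutValue_truncAt _ _) hab
        (R := 3 * l.length + 1 + R) (by omega)).mono ?_
      rintro _ m₁ n₁ ⟨h₁, h₂, h₃, h₄, h₅⟩
      have hle : m'.act i ≤ m₁.act i := h₂ ▸ le_update_of_le hab.le
      have hbe : m₁.act i e = b := by rw [h₂, Function.update_self]
      refine ⟨hl', ⟨h.same.trans h₁, h₃, fun e' => ?_, h.ge.trans hle, fun e' => ?_, fun e' => ?_⟩,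
        by omega⟩
      · by_cases hee : e' = e
        · rw [hee, hbe]
          exact isCutValue_truncAt _ _
        · rw [h₂, Function.update_of_ne hee]
          exact h.cut e'
      · by_cases hee : e' = e
        · rw [hee, hbe, hb, ← hev]
          -- The new value is computed from values below the fixed point, and the fixed point admits
          -- no raise.
          exact (truncAt_mono _ (ominus_mono (nodeVal_mono h.le _) _)).trans
            (isStable_fixPoint hG hcut e)
        · rw [h₂, Function.update_of_ne hee]
          exact h.le e'
      -- If the value of the target has changed, the target has been pushed; otherwise an inequality
      -- that held before persists, because edge values only grow.
      · by_cases hch : nodeVal G (m₁.act i) e'.dst = nodeVal G (m'.act i) e'.dst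
        · rw [hch]
          by_cases hee : e' = e
          · right; right
            rw [hee, hbe, hb, hev]
          · rcases h.stable e' with h' | h' | h'
            · exact .inl (h₄ _ (.inl h'))
            · exact .inr (.inl ((List.mem_cons.1 h').resolve_left hee))
            · exact .inr (.inr (h'.trans (hle e')))
        · exact .inl (h₄ _ (.inr hch))
    · rw [if_neg hab]
      refine Ok.pure ⟨hl', ⟨h.same, h.nodeOk, h.cut, h.ge, h.le, fun e' => ?_⟩, by omega⟩
      rcases h.stable e' with h' | h' | h'
      · exact .inl h'
      · rcases List.mem_cons.1 h' with h'' | h''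
        · right; right
          rw [h'', hev]
          exact not_lt.1 hab
        · exact .inr (.inl h'')
      · exact .inr (.inr h')
  · rw [Finset.length_toList]
    omega

variable (G) in
/-- The cost of putting a node on the work list at the start. -/
def initCost (u : V) : ℕ := 5 * (G.outEdges u).card + 3 * (G.inEdges u).card + 8

variable (G) in
theorem sum_initCost : ∑ u, initCost G u = 8 * G.E.card + 8 * Fintype.card V := by
  simp only [initCost, Finset.sum_add_distrib, ← Finset.mul_sum, sum_card_outEdges,
    sum_card_inEdges, Finset.sum_const, Finset.card_univ, smul_eq_mul]
  ring

/-- Besides the potential, the budget holds the initial pass over all nodes (`initCost`),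
`clearWork`, the last test of that pass, and the two steps of the final loop pass that finds the
work list empty. -/
theorem ok_fixPoint (hG : ∀ v : V, ∃ v', (v, v') ∈ G.E) (w : Fin k → V × V → ℤ) (W : ℕ)
    (i : Fin k) (m : Memory G k) {n R : ℕ}
    (hcut : ∀ e, IsCutValue (Fintype.card V * W) (m.act i e))
    (hn : potential G (Fintype.card V * W) (m.act i) + (8 * G.E.card + 8 * Fintype.card V) + 4 + R
      ≤ n) :
    (fixPoint G w W i).Ok n m fun _ m' n' => SameExcept i m m' ∧
      m'.act i = _root_.fixPoint G (w i) W (m.act i) ∧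
      (∀ u, m'.val i u = nodeVal G (m'.act i) u) ∧
      potential G (Fintype.card V * W) (m'.act i) + R ≤ n' := by
  unfold fixPoint
  refine Ok.bind (Ok.write (by omega) (Ok.bind (Ok.mono (Q := fun _ m' n' =>
    WorkInv (w i) W i m [] m' ∧
    potential G (Fintype.card V * W) (m'.act i) + workCost G m'.work + 2 + R ≤ n') ?_ ?_)))
  · refine Ok.forEach (fun l m' n' => SameExcept i m m' ∧ m'.act i = m.act i ∧
      (∀ u, u ∈ l ∨ u ∈ m'.work ∧ m'.NodeOk i u) ∧
      potential G (Fintype.card V * W) (m.act i) + workCost G m'.work + (l.map (initCost G)).sum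
        + 3 + R ≤ n') ?_ ?_ ?_
    · rintro m' n' ⟨h₁, h₂, h₃, h₄⟩
      rw [List.map_nil, List.sum_nil] at h₄
      have h₃' := fun u => (h₃ u).resolve_left (by simp)
      refine ⟨by omega, ⟨h₁, fun u => (h₃' u).2, fun e => ?_, h₂.ge, ?_,
        fun e => .inl (h₃' _).1⟩, ?_⟩
      · rw [h₂]; exact hcut e
      · rw [h₂]; exact le_fixPoint _ _ _
      · rw [h₂]; omega
    · rintro u l m' n' ⟨h₁, h₂, h₃, h₄⟩
      rw [List.map_cons, List.sum_cons, initCost] at h₄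
      refine ⟨by omega, Ok.bind ((ok_refresh i u m'
        (R := potential G (Fintype.card V * W) (m.act i) + workCost G (u :: m'.work)
          + (l.map (initCost G)).sum + 4 + R) ?_).mono ?_)⟩
      · rw [workCost_cons]
        omega
      rintro _ _ n₁ ⟨⟨x, c, rfl⟩, hu, hn₁⟩
      refine Ok.write (by omega) ⟨h₁.trans ⟨fun _ _ => rfl, fun _ _ => rfl, rfl, rfl⟩, h₂,
        fun v => ?_, ?_⟩
      · by_cases hv : v = u
        · rw [hv]
          exact .inr ⟨List.mem_cons_self, nodeOk_congr hu rfl rfl rfl⟩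
        · rcases h₃ v with h | ⟨h, h'⟩
          · exact .inl ((List.mem_cons.1 h).resolve_left hv)
          · exact .inr ⟨List.mem_cons_of_mem _ h,
              nodeOk_congr (nodeOk_withNode_of_ne h' hv) rfl rfl rfl⟩
      · change _ + workCost G (u :: m'.work) + _ + _ + _ ≤ _
        omega
    · refine ⟨⟨fun _ _ => rfl, fun _ _ => rfl, rfl, rfl⟩, rfl, fun u => .inl (by simp), ?_⟩
      rw [Finset.sum_map_toList, sum_initCost]
      change _ + 0 + _ + 3 + R ≤ _
      omega
  · rintro _ m' n' h
    refine Ok.loop (fun m' n' => WorkInv (w i) W i m [] m' ∧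
      potential G (Fintype.card V * W) (m'.act i) + workCost G m'.work + 2 + R ≤ n') ?_ h
    rintro m' n' ⟨hI, hn'⟩
    refine ⟨by omega, Ok.bind (Ok.step (by omega) ?_)⟩
    dsimp only
    rcases hw : m'.work with _ | ⟨v, l⟩
    · refine Ok.pure ?_
      refine ⟨hI.same.trans ⟨fun _ _ => rfl, fun _ _ => rfl, rfl, rfl⟩, ?_, fun u => (hI.nodeOk u).1,
        ?_⟩
      -- With an empty work list the invariant says that the stored function is stable, so it
      -- dominates the least fixed point.
      · refine le_antisymm hI.le (fixPoint_le hG hI.ge fun e => ?_)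
        rcases hI.stable e with h' | h' | h'
        · rw [hw] at h'
          exact absurd h' (by simp)
        · exact absurd h' (by simp)
        · exact h'
      · change potential G _ (m'.act i) + R ≤ _
        omega
    · rw [hw, workCost_cons] at hn'
      refine Ok.bind ((ok_treatNode hG w W i v (m₀ := m) (R := 2 + R) hcut ?_ ?_).mono ?_)
      · refine ⟨hI.same.trans ⟨fun _ _ => rfl, fun _ _ => rfl, rfl, rfl⟩,
          fun u => nodeOk_congr (hI.nodeOk u) rfl rfl rfl, hI.cut, hI.ge, hI.le, fun e => ?_⟩
        rcases hI.stable e with h' | h' | h'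
        · rw [hw] at h'
          rcases List.mem_cons.1 h' with h'' | h''
          · exact .inr (.inl (Finset.mem_toList.2 (GameGraph.mem_inEdges.2 h'')))
          · exact .inl h''
        · exact absurd h' (by simp)
        · exact .inr (.inr h')
      · change potential G _ (m'.act i) + workCost G l + _ + 1 + (2 + R) ≤ _
        omega
      · rintro _ m₁ n₁ ⟨h₁, h₂⟩
        exact Ok.pure ⟨h₁, by omega⟩

theorem ok_compute (hG : ∀ v : V, ∃ v', (v, v') ∈ G.E) (w : Fin k → V × V → ℤ) (W : ℕ)
    (i : Fin k) (m : Memory G k) {n R : ℕ}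
    (hcut : ∀ e, IsCutValue (Fintype.card V * W) (m.act i e))
    (hn : potential G (Fintype.card V * W) (m.act i) + (8 * G.E.card + 11 * Fintype.card V) + 5 + R
      ≤ n) :
    (compute G w W i).Ok n m fun _ m' n' => SameExcept i m m' ∧
      m'.act i = _root_.fixPoint G (w i) W (m.act i) ∧
      (∀ v, m'.wreg i v = true ↔ v ∈ regionOf G (m'.act i)) ∧
      potential G (Fintype.card V * W) (m'.act i) + R ≤ n' := by
  unfold compute
  refine Ok.bind ((ok_fixPoint hG w W i m (R := 3 * Fintype.card V + 1 + R) hcut (by omega)).mono ?_)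
  rintro _ m₁ n₁ ⟨h₁, h₂, h₃, h₄⟩
  refine Ok.forEach (fun l m' n' => SameExcept i m₁ m' ∧ m'.act i = m₁.act i ∧ m'.val i = m₁.val i ∧
    (∀ v, v ∈ l ∨ (m'.wreg i v = true ↔ v ∈ regionOf G (m₁.act i))) ∧
    potential G (Fintype.card V * W) (m₁.act i) + 3 * l.length + 1 + R ≤ n') ?_ ?_ ?_
  · rintro m' n' ⟨h₅, h₆, _, h₇, h₈⟩
    rw [List.length_nil] at h₈
    refine ⟨by omega, h₁.trans h₅, h₆.trans h₂, fun v => ?_, ?_⟩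
    · rw [h₆]
      exact (h₇ v).resolve_left (by simp)
    · rw [h₆]
      omega
  · rintro v l m' n' ⟨h₅, h₆, h₇, h₈, h₉⟩
    rw [List.length_cons] at h₉
    refine ⟨by omega, Ok.bind (Ok.read (by omega) (Ok.write (by omega)
      ⟨h₅.trans ⟨fun _ _ => rfl, fun j hj => ?_, rfl, rfl⟩, h₆, h₇, fun u => ?_, by omega⟩))⟩
    · simp [hj]
    · by_cases hu : u = v
      · right
        simp [hu, h₇, h₃, mem_regionOf]
      · rcases h₈ u with h | h
        · exact .inl ((List.mem_cons.1 h).resolve_left hu)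
        · right
          simpa [hu] using h
  · refine ⟨SameExcept.refl _ _, rfl, rfl, fun v => .inl (by simp), ?_⟩
    rw [Finset.length_toList, Finset.card_univ]
    omega

end Impl

/-! ### The remaining subroutines -/

namespace Impl

open Timed Memory

variable {V : Type} [Fintype V] [DecidableEq V] {G : GameGraph V} {k : ℕ}

/-- The computation for one objective leaves the data of the others alone, so their potentials can
be held in reserve and are still valid when their turn comes. -/
theorem ok_computeAll (hG : ∀ v : V, ∃ v', (v, v') ∈ G.E) (w : Fin k → V × V → ℤ) (W : ℕ)
    (m : Memory G k) {n R : ℕ} (hcut : ∀ i e, IsCutValue (Fintype.card V * W) (m.act i e))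
    (hn : ∑ i, potential G (Fintype.card V * W) (m.act i)
      + (8 * G.E.card + 11 * Fintype.card V + 6) * k + 1 + R ≤ n) :
    (forEach (List.finRange k) fun i => compute G w W i).Ok n m fun _ m' n' =>
      (∀ i, m'.act i = _root_.fixPoint G (w i) W (m.act i)) ∧
      (∀ i v, m'.wreg i v = true ↔ v ∈ regionOf G (m'.act i)) ∧ m'.cur = m.cur ∧ m'.nxt = m.nxt ∧
      ∑ i, potential G (Fintype.card V * W) (m'.act i) + R ≤ n' := by
  refine Ok.forEach (fun l m' n' => l.Nodup ∧ (∀ i, if i ∈ l then m'.act i = m.act i else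
      m'.act i = _root_.fixPoint G (w i) W (m.act i) ∧
      ∀ v, m'.wreg i v = true ↔ v ∈ regionOf G (m'.act i)) ∧ m'.cur = m.cur ∧ m'.nxt = m.nxt ∧
    ∑ i, potential G (Fintype.card V * W) (m'.act i)
      + (8 * G.E.card + 11 * Fintype.card V + 6) * l.length + 1 + R ≤ n') ?_ ?_
    ⟨List.nodup_finRange k, fun i => by simp, rfl, rfl, by rw [List.length_finRange]; exact hn⟩
  · rintro m' n' ⟨_, h₂, h₃, h₄, h₅⟩
    rw [List.length_nil] at h₅
    simp only [List.not_mem_nil, if_false] at h₂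
    exact ⟨by omega, fun i => (h₂ i).1, fun i => (h₂ i).2, h₃, h₄, by omega⟩
  · rintro i l m' n' ⟨h₁, h₂, h₃, h₄, h₅⟩
    obtain ⟨hil, hl⟩ := List.nodup_cons.1 h₁
    have hi := h₂ i
    rw [if_pos List.mem_cons_self] at hi
    rw [List.length_cons, Nat.mul_succ, ← Finset.add_sum_erase _ _ (Finset.mem_univ i)] at h₅
    refine ⟨by omega, (ok_compute hG w W i m'
      (R := ∑ j ∈ Finset.univ.erase i, potential G (Fintype.card V * W) (m'.act j)
        + (8 * G.E.card + 11 * Fintype.card V + 6) * l.length + 1 + R)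
      (by rw [hi]; exact hcut i) (by omega)).mono ?_⟩
    rintro _ m₁ n₁ ⟨h₆, h₇, h₈, h₉⟩
    refine ⟨hl, fun j => ?_, h₆.cur.trans h₃, h₆.nxt.trans h₄, ?_⟩
    · by_cases hj : j = i
      · rw [hj, if_neg hil, h₇, hi]
        refine ⟨rfl, fun v => ?_⟩
        rw [h₈, h₇, hi]
      · have := h₂ j
        simp only [List.mem_cons, hj, false_or] at this
        rwa [h₆.act j hj, h₆.wreg j hj]
    · have : ∑ j ∈ Finset.univ.erase i, potential G (Fintype.card V * W) (m₁.act j) =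
          ∑ j ∈ Finset.univ.erase i, potential G (Fintype.card V * W) (m'.act j) :=
        Finset.sum_congr rfl fun j hj => by rw [h₆.act j (Finset.ne_of_mem_erase hj)]
      rw [← Finset.add_sum_erase _ _ (Finset.mem_univ i), this]
      omega

theorem ok_intersect (m : Memory G k) {n R : ℕ}
    (hn : (3 * k + 3) * Fintype.card V + 1 + R ≤ n) :
    (intersect G).Ok n m fun _ m' n' => (∃ f, m' = { m with nxt := f } ∧
      ∀ v, f v = true ↔ ∀ i, m.wreg i v = true) ∧ R ≤ n' := by
  unfold intersect
  refine Ok.forEach (fun l m' n' => ∃ f, m' = { m with nxt := f } ∧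
    (∀ v, v ∈ l ∨ (f v = true ↔ ∀ i, m.wreg i v = true)) ∧ (3 * k + 3) * l.length + 1 + R ≤ n')
    ?_ ?_ ⟨m.nxt, rfl, fun v => .inl (by simp), by simpa using hn⟩
  · rintro m' n' ⟨f, h₁, h₂, h₃⟩
    rw [List.length_nil] at h₃
    exact ⟨by omega, ⟨f, h₁, fun v => (h₂ v).resolve_left (by simp)⟩, by omega⟩
  · rintro v l _ n' ⟨f, rfl, h₂, h₃⟩
    rw [List.length_cons, Nat.mul_succ] at h₃
    refine ⟨by omega, Ok.bind (Ok.write (by omega) ?_)⟩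
    refine Ok.forEach (fun l' m' n' => ∃ pre b, pre ++ l' = List.finRange k ∧
      m' = { m with nxt := Function.update f v b } ∧ (b = true ↔ ∀ i ∈ pre, m.wreg i v = true) ∧
      3 * l'.length + 1 + ((3 * k + 3) * l.length + 1 + R) ≤ n') ?_ ?_
      ⟨[], true, rfl, rfl, by simp, by rw [List.length_finRange]; omega⟩
    · rintro _ n₁ ⟨pre, b, hpre, rfl, hb, hn₁⟩
      rw [List.append_nil] at hpre
      rw [List.length_nil] at hn₁
      refine ⟨by omega, _, rfl, fun u => ?_, by omega⟩
      by_cases hu : u = v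
      · right
        rw [hu, Function.update_self, hb, hpre]
        simp
      · rw [Function.update_of_ne hu]
        exact (h₂ u).imp_left fun h => (List.mem_cons.1 h).resolve_left hu
    · rintro i l' _ n₁ ⟨pre, b, hpre, rfl, hb, hn₁⟩
      rw [List.length_cons] at hn₁
      refine ⟨by omega, Ok.bind (Ok.read (by omega) ?_)⟩
      dsimp only
      have hpre' : (pre ++ [i]) ++ l' = List.finRange k := by simpa using hpre
      by_cases hr : m.wreg i v = true
      · rw [if_pos hr]
        refine Ok.pure ⟨pre ++ [i], b, hpre', rfl, ?_, by omega⟩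
        rw [hb, List.forall_mem_append]
        simp [hr]
      · rw [if_neg hr]
        refine Ok.write (by omega) ⟨pre ++ [i], false, hpre', ?_, ?_, by omega⟩
        · simp
        · rw [List.forall_mem_append]
          simp [hr]

theorem ok_regionsDiffer (m : Memory G k) {n R : ℕ} (hn : 4 * Fintype.card V + 3 + R ≤ n) :
    (regionsDiffer (G := G)).Ok n m fun d m' n' =>
      (∃ b, m' = { m with flag := b }) ∧ (d = true ↔ m.cur ≠ m.nxt) ∧ R ≤ n' := by
  unfold regionsDiffer
  refine Ok.bind (Ok.write (by omega) (Ok.bind ?_))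
  refine Ok.forEach (fun l m' n' => ∃ b, m' = { m with flag := b } ∧
    (b = true → m.cur ≠ m.nxt) ∧ (∀ v, v ∈ l ∨ b = true ∨ m.cur v = m.nxt v) ∧
    4 * l.length + 2 + R ≤ n') ?_ ?_ ⟨false, rfl, by simp, fun v => .inl (by simp), ?_⟩
  · rintro _ n' ⟨b, rfl, h₁, h₂, h₃⟩
    rw [List.length_nil] at h₃
    refine ⟨by omega, Ok.read (by omega) ⟨⟨b, rfl⟩, ⟨h₁, fun h => ?_⟩, by omega⟩⟩
    by_contra hb
    exact h (funext fun v => ((h₂ v).resolve_left (by simp)).resolve_left hb)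
  · rintro v l _ n' ⟨b, rfl, h₁, h₂, h₃⟩
    rw [List.length_cons] at h₃
    refine ⟨by omega, Ok.bind (Ok.read (by omega) (Ok.bind (Ok.read (by omega) ?_)))⟩
    dsimp only
    by_cases h : m.cur v = m.nxt v
    · rw [if_pos h]
      refine Ok.pure ⟨b, rfl, h₁, fun u => ?_, by omega⟩
      rcases h₂ u with h' | h'
      · rcases List.mem_cons.1 h' with rfl | h''
        · exact .inr (.inr h)
        · exact .inl h''
      · exact .inr h'
    · rw [if_neg h]
      exact Ok.write (by omega)
        ⟨true, rfl, fun _ h' => h (congrFun h' v), fun u => .inr (.inl rfl), by omega⟩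
  · rw [Finset.length_toList, Finset.card_univ]
    omega

theorem ok_prune (m : Memory G k) {n R : ℕ} (hn : (2 * k + 5) * G.E.card + 1 + R ≤ n) :
    (prune G).Ok n m fun _ m' n' => (∃ f, m' = { m with act := f } ∧
      ∀ i e, f i e = if (m.nxt e.src && m.cur e.dst && !m.nxt e.dst) = true then ⊤ else m.act i e) ∧
      R ≤ n' := by
  unfold prune
  -- As the list has no duplicates, not being in `l` means exactly that the edge has been treated.
  refine Ok.forEach (fun l m' n' => l.Nodup ∧ ∃ f, m' = { m with act := f } ∧
    (∀ i e, f i e = if e ∉ l ∧ (m.nxt e.src && m.cur e.dst && !m.nxt e.dst) = true then ⊤ else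
      m.act i e) ∧ (2 * k + 5) * l.length + 1 + R ≤ n') ?_ ?_
    ⟨Finset.nodup_toList _, m.act, rfl, fun i e => by simp, ?_⟩
  · rintro m' n' ⟨_, f, h₁, h₂, h₃⟩
    rw [List.length_nil] at h₃
    exact ⟨by omega, ⟨f, h₁, by simpa using h₂⟩, by omega⟩
  · rintro e l _ n' ⟨h₀, f, rfl, h₂, h₃⟩
    rw [List.length_cons, Nat.mul_succ] at h₃
    obtain ⟨hel, hl⟩ := List.nodup_cons.1 h₀
    refine ⟨by omega, Ok.bind (Ok.read (by omega) (Ok.bind (Ok.read (by omega)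
      (Ok.bind (Ok.read (by omega) ?_)))))⟩
    dsimp only
    by_cases h : (m.nxt e.src && m.cur e.dst && !m.nxt e.dst) = true
    · rw [if_pos h]
      refine Ok.forEach (fun l' m' n' => ∃ f', m' = { m with act := f' } ∧
        (∀ i e', e' ≠ e → f' i e' = f i e') ∧ (∀ i, i ∈ l' ∨ f' i e = ⊤) ∧
        2 * l'.length + 1 + ((2 * k + 5) * l.length + 1 + R) ≤ n') ?_ ?_
        ⟨f, rfl, fun _ _ _ => rfl, fun i => .inl (by simp), by rw [List.length_finRange]; omega⟩
      · rintro _ n₁ ⟨f', rfl, h₄, h₅, h₆⟩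
        rw [List.length_nil] at h₆
        refine ⟨by omega, hl, f', rfl, fun i e' => ?_, by omega⟩
        by_cases he : e' = e
        · subst he
          rw [(h₅ i).resolve_left (by simp), if_pos ⟨hel, h⟩]
        · rw [h₄ i e' he, h₂]
          simp [he]
      · rintro i l' _ n₁ ⟨f', rfl, h₄, h₅, h₆⟩
        rw [List.length_cons] at h₆
        refine ⟨by omega, Ok.write (by omega) ⟨_, rfl, fun j e' he => ?_, fun j => ?_, by omega⟩⟩
        · by_cases hj : j = i
          · subst hj
            simp [he, h₄]
          · simp [hj, h₄ j e' he]
        · by_cases hj : j = i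
          · subst hj
            simp
          · rw [Function.update_of_ne hj]
            exact (h₅ j).imp_left fun h => (List.mem_cons.1 h).resolve_left hj
    · rw [if_neg h]
      refine Ok.pure ⟨hl, f, rfl, fun i e' => ?_, by omega⟩
      rw [h₂]
      by_cases he : e' = e
      · subst he
        simp [h]
      · simp [he]
  · rw [Finset.length_toList, Finset.card_univ, Fintype.card_coe]
    exact hn

theorem ok_copyRegion (m : Memory G k) {n R : ℕ} (hn : 3 * Fintype.card V + 1 + R ≤ n) :
    (forEach (Finset.univ : Finset V).toList fun v => do
      let a ← Timed.read fun m : Memory G k => m.nxt v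
      setCur v a).Ok n m fun _ m' n' => m' = { m with cur := m.nxt } ∧ R ≤ n' := by
  refine Ok.forEach (fun l m' n' => ∃ f, m' = { m with cur := f } ∧
    (∀ v, v ∈ l ∨ f v = m.nxt v) ∧ 3 * l.length + 1 + R ≤ n') ?_ ?_
    ⟨m.cur, rfl, fun v => .inl (by simp), by simpa using hn⟩
  · rintro _ n' ⟨f, rfl, h₁, h₂⟩
    rw [List.length_nil] at h₂
    refine ⟨by omega, ?_, by omega⟩
    rw [show f = m.nxt from funext fun v => (h₁ v).resolve_left (by simp)]
  · rintro v l _ n' ⟨f, rfl, h₁, h₂⟩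
    rw [List.length_cons] at h₂
    refine ⟨by omega, Ok.bind (Ok.read (by omega) (Ok.write (by omega)
      ⟨_, rfl, fun u => ?_, by omega⟩))⟩
    by_cases hu : u = v
    · simp [hu]
    · rw [Function.update_of_ne hu]
      exact (h₁ u).imp_left fun h => (List.mem_cons.1 h).resolve_left hu

theorem ok_initCur (m : Memory G k) {n R : ℕ} (hn : 2 * Fintype.card V + 1 + R ≤ n) :
    (forEach (Finset.univ : Finset V).toList fun v => setCur (G := G) (k := k) v true).Ok n m
      fun _ m' n' => m' = { m with cur := fun _ => true } ∧ R ≤ n' := by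
  refine Ok.forEach (fun l m' n' => ∃ f, m' = { m with cur := f } ∧
    (∀ v, v ∈ l ∨ f v = true) ∧ 2 * l.length + 1 + R ≤ n') ?_ ?_
    ⟨m.cur, rfl, fun v => .inl (by simp), by simpa using hn⟩
  · rintro _ n' ⟨f, rfl, h₁, h₂⟩
    rw [List.length_nil] at h₂
    refine ⟨by omega, ?_, by omega⟩
    rw [show f = fun _ => true from funext fun v => (h₁ v).resolve_left (by simp)]
  · rintro v l _ n' ⟨f, rfl, h₁, h₂⟩
    rw [List.length_cons] at h₂
    refine ⟨by omega, Ok.write (by omega) ⟨_, rfl, fun u => ?_, by omega⟩⟩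
    by_cases hu : u = v
    · simp [hu]
    · rw [Function.update_of_ne hu]
      exact (h₁ u).imp_left fun h => (List.mem_cons.1 h).resolve_left hu

theorem ok_initAct (m : Memory G k) {n R : ℕ} (hn : (2 * G.E.card + 2) * k + 1 + R ≤ n) :
    (forEach (List.finRange k) fun i =>
      forEach (Finset.univ : Finset G.Edge).toList fun e => setAct i e 0).Ok n m
      fun _ m' n' => m' = { m with act := fun _ _ => 0 } ∧ R ≤ n' := by
  refine Ok.forEach (fun l m' n' => ∃ f, m' = { m with act := f } ∧
    (∀ i, i ∈ l ∨ ∀ e, f i e = 0) ∧ (2 * G.E.card + 2) * l.length + 1 + R ≤ n') ?_ ?_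
    ⟨m.act, rfl, fun v => .inl (by simp), by simpa using hn⟩
  · rintro _ n' ⟨f, rfl, h₁, h₂⟩
    rw [List.length_nil] at h₂
    refine ⟨by omega, ?_, by omega⟩
    rw [show f = fun _ _ => 0 from
      funext fun i => funext fun e => (h₁ i).resolve_left (by simp) e]
  · rintro i l _ n' ⟨f, rfl, h₁, h₂⟩
    rw [List.length_cons, Nat.mul_succ] at h₂
    refine ⟨by omega, Ok.forEach (fun l' m' n' => ∃ f', m' = { m with act := f' } ∧
      (∀ j, j ≠ i → f' j = f j) ∧ (∀ e, e ∈ l' ∨ f' i e = 0) ∧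
      2 * l'.length + 1 + ((2 * G.E.card + 2) * l.length + 1 + R) ≤ n') ?_ ?_
      ⟨f, rfl, fun _ _ => rfl, fun e => .inl (by simp), ?_⟩⟩
    · rintro _ n₁ ⟨f', rfl, h₃, h₄, h₅⟩
      rw [List.length_nil] at h₅
      refine ⟨by omega, f', rfl, fun j => ?_, by omega⟩
      by_cases hj : j = i
      · right
        rw [hj]
        exact fun e => (h₄ e).resolve_left (by simp)
      · rw [h₃ j hj]
        exact (h₁ j).imp_left fun h => (List.mem_cons.1 h).resolve_left hj
    · rintro e l' _ n₁ ⟨f', rfl, h₃, h₄, h₅⟩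
      rw [List.length_cons] at h₅
      refine ⟨by omega, Ok.write (by omega) ⟨_, rfl, fun j hj => ?_, fun e' => ?_, by omega⟩⟩
      · simp [hj, h₃]
      · by_cases he : e' = e
        · simp [he]
        · rw [Function.update_self, Function.update_of_ne he]
          exact (h₄ e').imp_left fun h => (List.mem_cons.1 h).resolve_left he
    · rw [Finset.length_toList, Finset.card_univ, Fintype.card_coe]
      omega

/-- `c` is an outgoing edge of `v` of smallest value. -/
def IsBest (μ : G.Edge → ℕ∞) (v : V) (c : Option G.Edge) : Prop :=
  ∃ e, c = some e ∧ e.src = v ∧ ∀ e' ∈ G.outEdges v, μ e ≤ μ e'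

theorem ok_extract (hG : ∀ v : V, ∃ v', (v, v') ∈ G.E) (i : Fin k) (m : Memory G k) {n R : ℕ}
    (hn : 5 * G.E.card + 3 * Fintype.card V + 1 + R ≤ n) :
    (extract G i).Ok n m fun _ m' n' => (∃ f, m' = { m with choice := f } ∧
      (∀ j, j ≠ i → f j = m.choice j) ∧ ∀ v ∈ G.V0, IsBest (m.act i) v (f i v)) ∧ R ≤ n' := by
  unfold extract
  refine Ok.forEach (fun l m' n' => ∃ f, m' = { m with choice := f } ∧
    (∀ j, j ≠ i → f j = m.choice j) ∧ (∀ v, v ∈ l ∨ (v ∈ G.V0 → IsBest (m.act i) v (f i v))) ∧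
    (l.map fun v => 5 * (G.outEdges v).card + 3).sum + 1 + R ≤ n') ?_ ?_
    ⟨m.choice, rfl, fun _ _ => rfl, fun v => .inl (by simp), ?_⟩
  · rintro _ n' ⟨f, rfl, h₁, h₂, h₃⟩
    rw [List.map_nil, List.sum_nil] at h₃
    exact ⟨by omega, ⟨f, rfl, h₁, fun v => (h₂ v).resolve_left (by simp)⟩, by omega⟩
  · rintro v l _ n' ⟨f, rfl, h₁, h₂, h₃⟩
    rw [List.map_cons, List.sum_cons] at h₃
    refine ⟨by omega, ?_⟩
    by_cases hv : v ∈ G.V0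
    · rw [if_pos hv]
      refine Ok.bind (Ok.write (by omega) ?_)
      refine Ok.forEach (fun l' m' n' => ∃ pre c f', pre ++ l' = (G.outEdges v).toList ∧
        m' = { m with choice := f' } ∧ (∀ j, j ≠ i → f' j = m.choice j) ∧ f' i v = c ∧
        (∀ u, u ≠ v → f' i u = f i u) ∧ (pre ≠ [] → c ≠ none) ∧
        (∀ e, c = some e → e.src = v ∧ ∀ e' ∈ pre, m.act i e ≤ m.act i e') ∧
        5 * l'.length + 1 + ((l.map fun v => 5 * (G.outEdges v).card + 3).sum + 1 + R) ≤ n') ?_ ?_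
        ⟨[], none, Function.update f i (Function.update (f i) v none), rfl, rfl,
          fun j hj => by simp [hj, h₁], by simp, fun u hu => by simp [hu], by simp, by simp, ?_⟩
      · rintro _ n₁ ⟨pre, c, f', hpre, rfl, h₄, h₅, h₆, h₇, h₈, h₉⟩
        rw [List.append_nil] at hpre
        rw [List.length_nil] at h₉
        refine ⟨by omega, f', rfl, h₄, fun u => ?_, by omega⟩
        by_cases hu : u = v
        · right
          intro _
          subst hu
          -- The scan is not empty because every node has an outgoing edge; hence the initial `none`
          -- is overwritten.
          have hne : pre ≠ [] := by
            rw [hpre]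
            simpa using (G.outEdges_nonempty hG u).ne_empty
          obtain ⟨e, he⟩ := Option.ne_none_iff_exists'.1 (h₇ hne)
          refine ⟨e, h₅.trans he, (h₈ e he).1, fun e' he' => (h₈ e he).2 e' ?_⟩
          rw [hpre]
          exact Finset.mem_toList.2 he'
        · rw [h₆ u hu]
          exact (h₂ u).imp_left fun h => (List.mem_cons.1 h).resolve_left hu
      · rintro e l' _ n₁ ⟨pre, c, f', hpre, rfl, h₄, h₅, h₆, h₇, h₈, h₉⟩
        rw [List.length_cons] at h₉
        have hpre' : (pre ++ [e]) ++ l' = (G.outEdges v).toList := by simpa using hpre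
        have hev : e.src = v := by
          rw [← GameGraph.mem_outEdges, ← Finset.mem_toList, ← hpre]
          simp
        refine ⟨by omega, Ok.bind (Ok.read (by omega) ?_)⟩
        dsimp only
        rw [h₅]
        rcases c with _ | e₀
        · refine Ok.write (by omega) ⟨pre ++ [e], some e, _, hpre', rfl, fun j hj => ?_, ?_,
            fun u hu => ?_, by simp, ?_, by omega⟩
          · simp [hj, h₄]
          · simp
          · simp [hu, h₆]
          · have : pre = [] := by
              by_contra h
              exact h₇ h rfl
            simp [this, hev]
        · refine Ok.bind (Ok.read (by omega) (Ok.bind (Ok.read (by omega) ?_)))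
          dsimp only
          obtain ⟨h₁₀, h₁₁⟩ := h₈ e₀ rfl
          by_cases hlt : m.act i e < m.act i e₀
          · rw [if_pos hlt]
            refine Ok.write (by omega) ⟨pre ++ [e], some e, _, hpre', rfl, fun j hj => ?_, ?_,
              fun u hu => ?_, by simp, ?_, by omega⟩
            · simp [hj, h₄]
            · simp
            · simp [hu, h₆]
            · rintro _ ⟨⟩
              rw [List.forall_mem_append]
              exact ⟨hev, fun e' he' => hlt.le.trans (h₁₁ e' he'), by simp⟩
          · rw [if_neg hlt]
            refine Ok.pure ⟨pre ++ [e], some e₀, f', hpre', rfl, h₄, h₅, h₆, by simp, ?_, by omega⟩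
            rintro _ ⟨⟩
            rw [List.forall_mem_append]
            exact ⟨h₁₀, h₁₁, by simpa using hlt⟩
      · rw [Finset.length_toList]
        omega
    · rw [if_neg hv]
      refine Ok.pure ⟨f, rfl, h₁, fun u => ?_, by omega⟩
      by_cases hu : u = v
      · exact .inr fun h => absurd (hu ▸ h) hv
      · exact (h₂ u).imp_left fun h => (List.mem_cons.1 h).resolve_left hu
  · rw [Finset.sum_map_toList, Finset.sum_add_distrib, ← Finset.mul_sum, sum_card_outEdges,
      Finset.sum_const, Finset.card_univ, smul_eq_mul]
    omega

theorem ok_extractAll (hG : ∀ v : V, ∃ v', (v, v') ∈ G.E) (m : Memory G k) {n R : ℕ}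
    (hn : (5 * G.E.card + 3 * Fintype.card V + 2) * k + 1 + R ≤ n) :
    (forEach (List.finRange k) fun i => extract G i).Ok n m fun _ m' n' =>
      (∀ i, ∀ v ∈ G.V0, IsBest (m.act i) v (m'.choice i v)) ∧ R ≤ n' := by
  refine Ok.forEach (fun l m' n' => ∃ f, m' = { m with choice := f } ∧
    (∀ i, i ∈ l ∨ ∀ v ∈ G.V0, IsBest (m.act i) v (f i v)) ∧
    (5 * G.E.card + 3 * Fintype.card V + 2) * l.length + 1 + R ≤ n') ?_ ?_
    ⟨m.choice, rfl, fun v => .inl (by simp), by simpa using hn⟩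
  · rintro _ n' ⟨f, rfl, h₁, h₂⟩
    rw [List.length_nil] at h₂
    exact ⟨by omega, fun i => (h₁ i).resolve_left (by simp), by omega⟩
  · rintro i l _ n' ⟨f, rfl, h₁, h₂⟩
    rw [List.length_cons, Nat.mul_succ] at h₂
    refine ⟨by omega, (ok_extract hG i _
      (R := (5 * G.E.card + 3 * Fintype.card V + 2) * l.length + 1 + R) (by omega)).mono ?_⟩
    rintro _ _ n₁ ⟨⟨f', rfl, h₃, h₄⟩, h₅⟩
    refine ⟨f', rfl, fun j => ?_, h₅⟩
    by_cases hj : j = i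
    · right
      rw [hj]
      exact h₄
    · rw [h₃ j hj]
      exact (h₁ j).imp_left fun h => (List.mem_cons.1 h).resolve_left hj

end Impl

/-! ### The main loop -/

section MainLoop

variable {V : Type} [Fintype V] [DecidableEq V] {G : GameGraph V} {k : ℕ}

variable (G) in
/-- The variables of the main loop after `j` rounds. -/
def loopIter (w : Fin k → V × V → ℤ) (W j : ℕ) : LoopState G k :=
  (LoopState.body w W)^[j] (loopStart G w W)

variable {w : Fin k → V × V → ℤ} {W : ℕ}

theorem loopIter_succ (j : ℕ) :
    loopIter G w W (j + 1) = LoopState.body w W (loopIter G w W j) :=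
  Function.iterate_succ_apply' _ _ _

theorem act_loopIter_zero (i : Fin k) :
    ((loopIter G w W 0).tmpl i).act = fixPoint G (w i) W fun _ => 0 :=
  act_ofEdgeFun _

theorem act_loopIter_succ (j : ℕ) (i : Fin k) :
    ((loopIter G w W (j + 1)).tmpl i).act =
      fixPoint G (w i) W ((loopIter G w W j).pruned i) := by
  rw [loopIter_succ]
  exact act_ofEdgeFun _

theorem reg_loopIter_succ (j : ℕ) : (loopIter G w W (j + 1)).reg = (loopIter G w W j).reg' := by
  rw [loopIter_succ]
  rfl

theorem reg'_loopIter (j : ℕ) :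
    (loopIter G w W j).reg' = ⋂ i, regionOf G ((loopIter G w W j).tmpl i).act := by
  cases j with
  | zero =>
    simp only [act_loopIter_zero]
    rfl
  | succ j =>
    simp only [act_loopIter_succ]
    rw [loopIter_succ]
    rfl

theorem act_le_pruned (s : LoopState G k) (i : Fin k) : (s.tmpl i).act ≤ s.pruned i := by
  intro e
  unfold LoopState.pruned
  split_ifs
  exacts [le_top, le_rfl]

theorem isCutValue_pruned {s : LoopState G k} {i : Fin k} {B : ℕ}
    (h : ∀ e, IsCutValue B ((s.tmpl i).act e)) (e : G.Edge) : IsCutValue B (s.pruned i e) := by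
  unfold LoopState.pruned
  split_ifs
  exacts [.inr rfl, h e]

theorem isCutValue_loopIter (j : ℕ) (i : Fin k) (e : G.Edge) :
    IsCutValue (Fintype.card V * W) (((loopIter G w W j).tmpl i).act e) := by
  induction j generalizing e with
  | zero =>
    rw [act_loopIter_zero]
    exact isCutValue_fixPoint (fun _ => .inl bot_le) e
  | succ j ih =>
    rw [act_loopIter_succ]
    exact isCutValue_fixPoint (isCutValue_pruned ih) e

/-- Edge values grow from round to round, and regions shrink as values grow. -/
theorem reg'_loopIter_subset (j : ℕ) : (loopIter G w W j).reg' ⊆ (loopIter G w W j).reg := by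
  cases j with
  | zero => exact fun _ _ => Set.mem_univ _
  | succ j =>
    rw [reg_loopIter_succ, reg'_loopIter, reg'_loopIter]
    refine Set.iInter_mono fun i => regionOf_anti ?_
    rw [act_loopIter_succ]
    exact (act_le_pruned _ i).trans (le_fixPoint _ _ _)

end MainLoop

/-! ### The rounds of the implementation and the total cost -/

namespace Impl

open Timed Memory

variable {V : Type} [Fintype V] [DecidableEq V] {G : GameGraph V} {k : ℕ}

/-- The memory stores the variables of the main loop. -/
structure Stores (m : Memory G k) (s : LoopState G k) : Prop where
  cur : ∀ v, m.cur v = true ↔ v ∈ s.reg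
  nxt : ∀ v, m.nxt v = true ↔ v ∈ s.reg'
  act : ∀ i, m.act i = (s.tmpl i).act

/-- The potential that is not spent is handed on to the next round: pruning only raises values,
hence only lowers the potential. All other costs of the round are independent of `W`. -/
theorem ok_round (hG : ∀ v : V, ∃ v', (v, v') ∈ G.E) (w : Fin k → V × V → ℤ) (W j : ℕ)
    (m : Memory G k) {n R : ℕ} (hm : Stores m (loopIter G w W j))
    (hn : ∑ i, potential G (Fintype.card V * W) (m.act i) + (2 * k + 5) * G.E.card
      + (8 * G.E.card + 11 * Fintype.card V + 6) * k + (3 * k + 3) * Fintype.card V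
      + 3 * Fintype.card V + 4 + R ≤ n) :
    (do
      prune G
      forEach (List.finRange k) fun i => compute G w W i
      forEach (Finset.univ : Finset V).toList fun v => do
        let a ← Timed.read fun m => m.nxt v
        setCur v a
      intersect G
      pure true : Timed (Memory G k) Bool).Ok n m fun b m' n' => b = true ∧ m'.cur = m.nxt ∧
        Stores m' (loopIter G w W (j + 1)) ∧
        ∑ i, potential G (Fintype.card V * W) (m'.act i) + R ≤ n' := by
  refine Ok.bind ((ok_prune m (R := ∑ i, potential G (Fintype.card V * W) (m.act i)
    + (8 * G.E.card + 11 * Fintype.card V + 6) * k + (3 * k + 3) * Fintype.card V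
    + 3 * Fintype.card V + 3 + R) (by omega)).mono ?_)
  rintro _ _ n₁ ⟨⟨f, rfl, hf⟩, hn₁⟩
  have hf' : ∀ i, f i = (loopIter G w W j).pruned i := by
    intro i
    funext e
    have hiff : (m.nxt e.src && m.cur e.dst && !m.nxt e.dst) = true ↔
        e.src ∈ (loopIter G w W j).reg' ∧
          e.dst ∈ (loopIter G w W j).reg \ (loopIter G w W j).reg' := by
      rw [Bool.and_eq_true, Bool.and_eq_true, hm.nxt, hm.cur, Bool.not_eq_true', ← Bool.not_eq_true,
        hm.nxt, and_assoc]
      rfl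
    rw [hf, LoopState.pruned]
    split_ifs with h₁ h₂ h₂
    · rfl
    · exact absurd (hiff.1 h₁) h₂
    · exact absurd (hiff.2 h₂) h₁
    · rw [hm.act]
  have hcut : ∀ i e, IsCutValue (Fintype.card V * W) (f i e) := fun i e => by
    rw [hf']
    exact isCutValue_pruned (isCutValue_loopIter j i) e
  have hpot : ∑ i, potential G (Fintype.card V * W) (f i) ≤
      ∑ i, potential G (Fintype.card V * W) (m.act i) :=
    Finset.sum_le_sum fun i _ => potential_anti _ (by rw [hf', hm.act]; exact act_le_pruned _ i)
  refine Ok.bind ((ok_computeAll hG w W _ (R := (3 * k + 3) * Fintype.card V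
    + 3 * Fintype.card V + 2 + R) hcut ?_).mono ?_)
  · dsimp only
    omega
  rintro _ m₂ n₂ ⟨h₁, h₂, _, h₃, hn₂⟩
  dsimp only at h₁ h₃
  refine Ok.bind ((ok_copyRegion m₂ (R := ∑ i, potential G (Fintype.card V * W) (m₂.act i)
    + (3 * k + 3) * Fintype.card V + 1 + R) (by omega)).mono ?_)
  rintro _ _ n₃ ⟨rfl, hn₃⟩
  refine Ok.bind ((ok_intersect _ (R := ∑ i, potential G (Fintype.card V * W) (m₂.act i) + R)
    (by omega)).mono ?_)
  rintro _ _ n₄ ⟨⟨g, rfl, hg⟩, hn₄⟩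
  have hact : ∀ i, m₂.act i = ((loopIter G w W (j + 1)).tmpl i).act := fun i => by
    rw [h₁, hf', act_loopIter_succ]
  refine Ok.pure ⟨rfl, h₃, ⟨fun v => ?_, fun v => ?_, hact⟩, hn₄⟩
  · dsimp only
    rw [h₃, hm.nxt, reg_loopIter_succ]
  · dsimp only at hg ⊢
    rw [hg, reg'_loopIter, Set.mem_iInter]
    exact forall_congr' fun i => by rw [h₂, hact]

theorem ok_combineQaSTel (hG : ∀ v : V, ∃ v', (v, v') ∈ G.E) (w : Fin k → V × V → ℤ) (W : ℕ)
    (m : Memory G k) {n : ℕ}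
    (hn : (12 * G.E.card + 7 * Fintype.card V) * (Fintype.card V * W + 1) * k
      + ((2 * k + 5) * G.E.card + (8 * G.E.card + 11 * Fintype.card V + 6) * k
        + (3 * k + 3) * Fintype.card V + 7 * Fintype.card V + 8) * (Fintype.card V + 1)
      + (8 * G.E.card + 11 * Fintype.card V + 6) * k + (3 * k + 3) * Fintype.card V
      + (5 * G.E.card + 3 * Fintype.card V + 2) * k + 2 * Fintype.card V
      + (2 * G.E.card + 2) * k + 5 ≤ n) :
    (combineQaSTel G w W).Ok n m fun _ m' _ => ∃ j,
      (∀ j' < j, (loopIter G w W j').reg ≠ (loopIter G w W j').reg') ∧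
      (loopIter G w W j).reg = (loopIter G w W j).reg' ∧
      ∀ i, ∀ v ∈ G.V0, IsBest ((loopIter G w W j).tmpl i).act v (m'.choice i v) := by
  set P := (12 * G.E.card + 7 * Fintype.card V) * (Fintype.card V * W + 1) * k with hP
  set D := (2 * k + 5) * G.E.card + (8 * G.E.card + 11 * Fintype.card V + 6) * k
        + (3 * k + 3) * Fintype.card V + 7 * Fintype.card V + 8 with hD
  set F := (5 * G.E.card + 3 * Fintype.card V + 2) * k with hF
  have hpot : ∑ _i : Fin k, potential G (Fintype.card V * W) (fun _ => 0) ≤ P := by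
    rw [hP, Finset.sum_const, Finset.card_univ, Fintype.card_fin, smul_eq_mul, mul_comm]
    exact Nat.mul_le_mul_right _ (potential_le _ _)
  unfold combineQaSTel
  refine Ok.bind ((ok_initCur m (R := P + D * (Fintype.card V + 1)
    + (8 * G.E.card + 11 * Fintype.card V + 6) * k + (3 * k + 3) * Fintype.card V + F
    + (2 * G.E.card + 2) * k + 4) (by omega)).mono ?_)
  rintro _ _ n₁ ⟨rfl, hn₁⟩
  refine Ok.bind ((ok_initAct _ (R := P + D * (Fintype.card V + 1)
    + (8 * G.E.card + 11 * Fintype.card V + 6) * k + (3 * k + 3) * Fintype.card V + F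
    + 3) (by omega)).mono ?_)
  rintro _ _ n₂ ⟨rfl, hn₂⟩
  refine Ok.bind ((ok_computeAll hG w W _ (R := D * (Fintype.card V + 1)
    + (3 * k + 3) * Fintype.card V + F + 2) (fun _ _ => .inl bot_le) ?_).mono ?_)
  · dsimp only
    omega
  rintro _ m₃ n₃ ⟨h₁, h₂, h₃, _, hn₃⟩
  dsimp only at h₁ h₃
  refine Ok.bind ((ok_intersect m₃ (R := ∑ i, potential G (Fintype.card V * W) (m₃.act i)
    + D * (Fintype.card V + 1) + F + 1) (by omega)).mono ?_)
  rintro _ _ n₄ ⟨⟨g, rfl, hg⟩, hn₄⟩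
  refine Ok.bind (Ok.mono (Q := fun _ m' n' => ∃ j,
    (∀ j' < j, (loopIter G w W j').reg ≠ (loopIter G w W j').reg') ∧
    (loopIter G w W j).reg = (loopIter G w W j).reg' ∧ Stores m' (loopIter G w W j) ∧
    F + 1 ≤ n') ?_ ?_)
  -- `D` covers the overhead of a round together with `regionsDiffer` and the loop step. Each round
  -- removes a node from `cur`, so one `D` for every node of `cur` and one more for the last test
  -- suffice.
  · refine Ok.loop (fun m' n' => ∃ j,
      (∀ j' < j, (loopIter G w W j').reg ≠ (loopIter G w W j').reg') ∧
      Stores m' (loopIter G w W j) ∧ ∑ i, potential G (Fintype.card V * W) (m'.act i)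
        + D * ((Finset.univ.filter fun v => m'.cur v = true).card + 1) + F + 1 ≤ n') ?_
      ⟨0, by simp, ⟨fun v => ?_, fun v => ?_, fun i => ?_⟩, ?_⟩
    · rintro m' n' ⟨j, hj, hm', hn'⟩
      rw [Nat.mul_succ] at hn'
      refine ⟨by omega, Ok.bind ((ok_regionsDiffer m'
        (R := ∑ i, potential G (Fintype.card V * W) (m'.act i)
        + D * (Finset.univ.filter fun v => m'.cur v = true).card
        + ((2 * k + 5) * G.E.card + (8 * G.E.card + 11 * Fintype.card V + 6) * k
        + (3 * k + 3) * Fintype.card V + 3 * Fintype.card V + 4) + F + 1) (by omega)).mono ?_)⟩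
      rintro d _ n₅ ⟨⟨b, rfl⟩, hd, hn₅⟩
      have hreg : m'.cur = m'.nxt ↔ (loopIter G w W j).reg = (loopIter G w W j).reg' := by
        rw [Set.ext_iff, funext_iff]
        exact forall_congr' fun v => by rw [← hm'.cur, ← hm'.nxt, Bool.eq_iff_iff]
      have hm'' : Stores { m' with flag := b } (loopIter G w W j) := ⟨hm'.cur, hm'.nxt, hm'.act⟩
      cases d with
      | true =>
        have hne := hd.1 rfl
        refine (ok_round hG w W j _ (R := D * (Finset.univ.filter fun v => m'.cur v = true).card
          + F + 1) hm'' ?_).mono ?_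
        · dsimp only
          omega
        rintro _ m₆ n₆ ⟨rfl, h₄, h₅, h₆⟩
        refine ⟨j + 1, fun j' hj' => ?_, h₅, ?_⟩
        · rcases Nat.lt_succ_iff_lt_or_eq.1 hj' with h | rfl
          · exact hj j' h
          · exact fun h => hne (hreg.2 h)
        · have : (Finset.univ.filter fun v => m₆.cur v = true).card <
              (Finset.univ.filter fun v => m'.cur v = true).card := by
            refine Finset.card_lt_card (Finset.ssubset_iff_subset_ne.2 ⟨fun v hv => ?_, fun h => ?_⟩)
            · rw [h₄, Finset.mem_filter] at hv
              exact Finset.mem_filter.2 ⟨hv.1,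
                (hm'.cur v).2 (reg'_loopIter_subset j ((hm'.nxt v).1 hv.2))⟩
            · refine hne (funext fun v => ?_)
              rw [Bool.eq_iff_iff]
              have := Finset.ext_iff.1 h v
              rw [h₄] at this
              simpa using this.symm
          have := Nat.mul_le_mul_left D (Nat.succ_le_of_lt this)
          rw [Nat.succ_eq_add_one] at this
          omega
      | false =>
        refine Ok.pure ⟨j, hj, hreg.1 ?_, hm'', by omega⟩
        by_contra h
        exact absurd (hd.2 h) (by simp)
    · dsimp only
      rw [h₃]
      simp [loopIter, loopStart]
    · dsimp only
      rw [hg, reg'_loopIter, Set.mem_iInter]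
      exact forall_congr' fun i => by rw [h₂, h₁, act_loopIter_zero]
    · dsimp only
      rw [h₁, act_loopIter_zero]
    · dsimp only
      have := Nat.mul_le_mul_left D (Nat.succ_le_succ
        (Finset.card_le_univ (Finset.univ.filter fun v => m₃.cur v = true)))
      rw [Nat.succ_eq_add_one, Nat.succ_eq_add_one] at this
      omega
  · rintro _ m₇ n₇ ⟨j, h₄, h₅, h₆, h₇⟩
    refine (ok_extractAll hG m₇ (R := 0) (by omega)).mono ?_
    rintro _ m₈ n₈ ⟨h₈, _⟩
    refine ⟨j, h₄, h₅, fun i v hv => ?_⟩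
    rw [← h₆.act]
    exact h₈ i v hv

/-- Every node has an outgoing edge, so `|V| ≤ |E|`. With `1 ≤ k` and `1 ≤ W` all lower-order terms
are absorbed by the main product. -/
theorem cost_combineQaSTel_le [Nonempty V] (hG : ∀ v : V, ∃ v', (v, v') ∈ G.E) [NeZero k] {W : ℕ}
    (hW : 0 < W) :
    (12 * G.E.card + 7 * Fintype.card V) * (Fintype.card V * W + 1) * k
      + ((2 * k + 5) * G.E.card + (8 * G.E.card + 11 * Fintype.card V + 6) * k
        + (3 * k + 3) * Fintype.card V + 7 * Fintype.card V + 8) * (Fintype.card V + 1)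
      + (8 * G.E.card + 11 * Fintype.card V + 6) * k + (3 * k + 3) * Fintype.card V
      + (5 * G.E.card + 3 * Fintype.card V + 2) * k + 2 * Fintype.card V
      + (2 * G.E.card + 2) * k + 5 ≤ 300 * (k * Fintype.card V * G.E.card * W) := by
  have hk : 1 ≤ k := NeZero.pos k
  have hV : 1 ≤ Fintype.card V := Fintype.card_pos
  have hVE : Fintype.card V ≤ G.E.card := by
    rw [← sum_card_outEdges, ← Finset.card_univ, Finset.card_eq_sum_ones]
    exact Finset.sum_le_sum fun v _ => (G.outEdges_nonempty hG v).card_pos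
  generalize Fintype.card V = a at *
  generalize G.E.card = b at *
  have h₁ : (12 * b + 7 * a) * (a * W + 1) * k ≤ 38 * (k * a * b * W) := by
    calc (12 * b + 7 * a) * (a * W + 1) * k ≤ (19 * b) * (2 * (a * W)) * k := by
          have : 1 ≤ a * W := Nat.mul_pos hV hW
          gcongr <;> omega
      _ = _ := by ring
  have h₂ : (2 * k + 5) * b + (8 * b + 11 * a + 6) * k + (3 * k + 3) * a + 7 * a + 8 ≤
      53 * (k * b) := by
    nlinarith [Nat.mul_le_mul hk (hV.trans hVE), Nat.mul_le_mul_left k hVE,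
      Nat.mul_le_mul_left k (hV.trans hVE), Nat.mul_le_mul_right b hk]
  have h₃ : ((2 * k + 5) * b + (8 * b + 11 * a + 6) * k + (3 * k + 3) * a + 7 * a + 8) * (a + 1) ≤
      106 * (k * a * b * W) := by
    calc _ ≤ (53 * (k * b)) * (2 * a * W) := by
          refine Nat.mul_le_mul h₂ ?_
          calc a + 1 ≤ 2 * a * 1 := by omega
            _ ≤ _ := Nat.mul_le_mul_left _ hW
      _ = _ := by ring
  have h₄ : k * b ≤ k * a * b * W := by
    calc k * b = k * 1 * b * 1 := by ring
      _ ≤ _ := by gcongr; exact hW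
  have h₅ : (8 * b + 11 * a + 6) * k + (3 * k + 3) * a + (5 * b + 3 * a + 2) * k + 2 * a
      + (2 * b + 2) * k + 5 ≤ 100 * (k * b) := by
    nlinarith [Nat.mul_le_mul hk (hV.trans hVE), Nat.mul_le_mul_left k hVE,
      Nat.mul_le_mul_left k (hV.trans hVE), Nat.mul_le_mul_right b hk]
  omega

/-- The procedure halts in time and stores a strategy returned by `CombineQaSTel`. -/
theorem combineQaSTel_halts [Nonempty V] (hG : ∀ v : V, ∃ v', (v, v') ∈ G.E) [NeZero k]
    (w : Fin k → V × V → ℤ) {W : ℕ} (hW : 0 < W) (m₀ : Memory G k) :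
    ∃ (m : Memory G k) (r : ℕ) (πs : Fin k → G.Positional),
      (combineQaSTel G w W).run (300 * (k * Fintype.card V * G.E.card * W)) m₀ = some ((), m, r) ∧
      (∀ i, ∀ v ∈ G.V0, (m.choice i v).map (fun e => e.1) = some (v, (πs i).next v)) ∧
      CombineReturns w W (combineStrat w πs) := by
  obtain ⟨_, m, r, hrun, _, j, h₁, h₂, h₃⟩ := ok_combineQaSTel hG w W m₀
    (cost_combineQaSTel_le (G := G) (k := k) hG hW)
  -- `choose!` needs a default edge for the nodes outside `V0`, where nothing is extracted.
  have : Nonempty G.Edge :=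
    ⟨⟨_, (hG (Classical.arbitrary V)).choose_spec⟩⟩
  choose! e he hsrc hmin using h₃
  have hpair : ∀ i, ∀ v ∈ G.V0, (e i v).1 = (v, (e i v).dst) := fun i v hv =>
    Prod.ext (hsrc i v hv) rfl
  let πs : Fin k → G.Positional := fun i =>
    ⟨fun v => (e i v).dst, fun v hv => hpair i v hv ▸ (e i v).2⟩
  refine ⟨m, r, πs, hrun, fun i v hv => ?_, j, h₁, h₂, πs, fun i v hv e' he' => ?_, rfl⟩
  · rw [he i v hv, Option.map_some, hpair i v hv]
  · have : (⟨(v, (πs i).next v), (πs i).valid v hv⟩ : G.Edge) = e i v :=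
      Subtype.ext (hpair i v hv).symm
    rw [this]
    exact hmin i v hv e' he'

end Impl

/-! ### Mean payoff of plays -/

section MeanPayoff

variable {V : Type}

theorem playPrefix_succ (ρ : ℕ → V) (n : ℕ) :
    playPrefix ρ (n + 1) = ρ 0 :: playPrefix (fun j => ρ (j + 1)) n := by
  rw [playPrefix, List.range_succ_eq_map, List.map_cons, List.map_map]
  rfl

theorem pathWeight_playPrefix (w : V × V → ℤ) (ρ : ℕ → V) (n : ℕ) :
    pathWeight w (playPrefix ρ n) = ∑ j ∈ Finset.range n, w (ρ j, ρ (j + 1)) := by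
  induction n generalizing ρ with
  | zero => rfl
  | succ n ih =>
    rw [Finset.sum_range_succ', ← ih fun j => ρ (j + 1), add_comm (pathWeight _ _), playPrefix_succ]
    cases n with
    | zero => rfl
    | succ n =>
      rw [playPrefix_succ]
      rfl

theorem pathAvg_playPrefix (w : V × V → ℤ) (ρ : ℕ → V) (n : ℕ) :
    pathAvg w (playPrefix ρ n) = ((∑ j ∈ Finset.range n, w (ρ j, ρ (j + 1)) : ℤ) : ℝ) / n := by
  rw [pathAvg, pathWeight_playPrefix, playPrefix, List.length_map, List.length_range]
  congr 1
  push_cast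
  ring

/-- Clears the denominator and removes `EReal`; the index `n = 0`, where the average is `0 / 0`, is
irrelevant for a frequent statement. -/
theorem mem_meanPayoff_iff {w : V × V → ℤ} {ρ : ℕ → V} :
    ρ ∈ MeanPayoff w ↔ ∀ ε : ℝ, 0 < ε → ∃ᶠ n : ℕ in atTop,
      -ε * n ≤ ((∑ j ∈ Finset.range n, w (ρ j, ρ (j + 1)) : ℤ) : ℝ) := by
  rw [MeanPayoff, Set.mem_ofPred_eq, le_limsup_iff]
  simp only [pathAvg_playPrefix]
  constructor
  · intro h ε hε
    refine (h ((-ε : ℝ) : EReal) (by exact_mod_cast neg_lt_zero.2 hε)).mp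
      ((eventually_gt_atTop 0).mono fun n hn hlt => ?_)
    have hn' : (0 : ℝ) < n := by exact_mod_cast hn
    have := (EReal.coe_lt_coe_iff.1 hlt).le
    rwa [le_div_iff₀ hn'] at this
  · intro h y hy
    obtain ⟨x, hyx, hx⟩ := EReal.lt_iff_exists_real_btwn.1 hy
    have hx0 : x < 0 := by exact_mod_cast hx
    refine (h (-x) (by linarith)).mp ((eventually_gt_atTop 0).mono fun n hn hle => ?_)
    have hn' : (0 : ℝ) < n := by exact_mod_cast hn
    refine hyx.trans_le (EReal.coe_le_coe_iff.2 ?_)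
    rw [le_div_iff₀ hn']
    linarith

/-- Needed to pass from a winning strategy to what remains of it after a move. -/
theorem meanPayoff_tail {w : V × V → ℤ} {ρ : ℕ → V} (h : ρ ∈ MeanPayoff w) :
    (fun j => ρ (j + 1)) ∈ MeanPayoff w := by
  rw [mem_meanPayoff_iff] at h ⊢
  intro ε hε
  rw [frequently_atTop]
  intro a
  -- From `c` moves on, the spare half of the tolerance outweighs both the weight of the dropped
  -- edge and the shift of the length by one.
  obtain ⟨c, hc⟩ := exists_nat_gt ((|(w (ρ 0, ρ 1) : ℝ)| + ε / 2) / (ε / 2))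
  obtain ⟨n, hn, hle⟩ := (frequently_atTop.1 (h (ε / 2) (by linarith))) (max a c + 1)
  obtain ⟨n, rfl⟩ := Nat.exists_eq_add_of_le' (le_trans (Nat.le_add_left 1 _) hn)
  refine ⟨n, by omega, ?_⟩
  rw [Finset.sum_range_succ'] at hle
  push_cast at hle ⊢
  rw [div_lt_iff₀ (by linarith)] at hc
  have hcn : (c : ℝ) ≤ n := by exact_mod_cast (by omega : c ≤ n)
  have := mul_le_mul_of_nonneg_right hcn (by linarith : 0 ≤ ε / 2)
  have := le_abs_self (w (ρ 0, ρ 1) : ℝ)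
  linarith

end MeanPayoff

/-! ### The winning region -/

section WinRegion

variable {V : Type} [Fintype V] [DecidableEq V] {G : GameGraph V}

/-- The strategy after the first move from `v`. -/
def GameGraph.Strategy.after (π : G.Strategy) (v : V) : G.Strategy where
  next H u := π.next (v :: H) u
  valid H u hu := π.valid (v :: H) u hu

/-- Prepending `v` to a play of the residual strategy gives a play of `π` from `v`, which lies in
`φ`; closure under tails removes `v` again. -/
theorem GameGraph.Strategy.WinsFrom.after {φ : Set (ℕ → V)}
    (hφ : ∀ ρ ∈ φ, (fun j => ρ (j + 1)) ∈ φ) {π : G.Strategy} {v v' : V} (h : π.WinsFrom φ v)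
    (he : (v, v') ∈ G.E) (hv : v ∈ G.V0 → v' = π.next [] v) : (π.after v).WinsFrom φ v' := by
  rintro ρ ⟨hρ, hπ⟩ h0
  let ρ' : ℕ → V := fun n => Nat.casesOn n v ρ
  refine hφ ρ' (h ρ' ⟨fun j => ?_, fun j hj => ?_⟩ rfl)
  · cases j with
    | zero =>
      change (v, ρ 0) ∈ G.E
      rwa [h0]
    | succ j => exact hρ j
  · cases j with
    | zero =>
      change ρ 0 = _
      rw [h0]
      exact hv hj
    | succ j =>
      rw [List.range_succ_eq_map, List.map_cons, List.map_map]
      exact hπ j hj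

end WinRegion

/-! ### Potentials -/

section Potentials

variable {V : Type} [Fintype V] [DecidableEq V] {G : GameGraph V}

/-- `h` gives for every node of `S` a credit with which Player 0 can keep the energy non-negative
without leaving `S`. -/
def IsPotential (G : GameGraph V) (w : V × V → ℤ) (S : Set V) (h : V → ℕ) : Prop :=
  ∀ u ∈ S, (u ∈ G.V0 → ∃ v ∈ S, (u, v) ∈ G.E ∧ (h v : ℤ) - w (u, v) ≤ h u) ∧
    (u ∉ G.V0 → ∀ v, (u, v) ∈ G.E → v ∈ S ∧ (h v : ℤ) - w (u, v) ≤ h u)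

/-- A potential that exceeds `(|V| - 1) · W` can be lowered, since some interval of length `W` below
contains no value. -/
theorem IsPotential.exists_lower {w : V × V → ℤ} {S : Set V} {W : ℕ} (hW : 0 < W)
    (hw : ∀ e ∈ G.E, |w e| ≤ (W : ℤ)) {h : V → ℕ} (hh : IsPotential G w S h) {v₀ : V}
    (hlarge : (Fintype.card V - 1) * W < h v₀) :
    ∃ h', IsPotential G w S h' ∧ ∑ v, h' v < ∑ v, h v := by
  classical
  have hc : ∀ v l, h v ⌈/⌉ W ≤ l ↔ h v ≤ W * l := fun v l => ceilDiv_le_iff_le_mul hW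
  -- The class of a node is `h v / W` rounded up: class `0` is the value `0`, and class `l > 0` is
  -- the interval `(W(l-1), Wl]`. The node `v₀` is in a class at least `|V|`, so the other `|V| - 1`
  -- nodes miss one of the classes below `|V|`.
  obtain ⟨l, hl, hgap⟩ : ∃ l < Fintype.card V, ∀ v ∈ S, h v ⌈/⌉ W ≠ l := by
    have hcard : ((Finset.univ.erase v₀).image fun v => h v ⌈/⌉ W).card <
        (Finset.range (Fintype.card V)).card := by
      refine Finset.card_image_le.trans_lt ?_
      rw [Finset.card_erase_of_mem (Finset.mem_univ _), Finset.card_univ, Finset.card_range]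
      exact Nat.sub_lt (Fintype.card_pos_iff.2 ⟨v₀⟩) one_pos
    obtain ⟨l, hl, hl'⟩ := Finset.exists_mem_notMem_of_card_lt_card hcard
    rw [Finset.mem_range] at hl
    refine ⟨l, hl, fun v _ hv => ?_⟩
    by_cases hvv : v = v₀
    · rw [hvv] at hv
      have h₁ := (hc v₀ (Fintype.card V - 1)).1 (by omega)
      rw [mul_comm] at h₁
      omega
    · exact hl' (Finset.mem_image.2 ⟨v, Finset.mem_erase.2 ⟨hvv, Finset.mem_univ v⟩, hv⟩)
  have hhigh : ∀ v, l < h v ⌈/⌉ W ↔ W * l < h v := fun v => by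
    rw [← not_le, hc, not_le]
  have hlow : ∀ v ∈ S, ¬ l < h v ⌈/⌉ W → h v + W ≤ W * l := fun v hv hvl => by
    have h₁ := hgap v hv
    obtain ⟨l', rfl⟩ : ∃ l', l = l' + 1 := ⟨l - 1, by omega⟩
    have := (hc v l').1 (by omega)
    rw [Nat.mul_succ]
    omega
  let h' : V → ℕ := fun v => if l < h v ⌈/⌉ W then h v - 1 else h v
  have hle : ∀ v, h' v ≤ h v := fun v => by
    dsimp only [h']
    split_ifs <;> omega
  -- Only an edge from a lowered node to one that is not lowered is critical. Across the empty class
  -- the values differ by more than `W`, so even weight `-W` leaves room for subtracting one. For `l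
  -- = 0` no node of `S` remains unlowered.
  have key : ∀ u ∈ S, ∀ v ∈ S, (u, v) ∈ G.E → (h v : ℤ) - w (u, v) ≤ h u →
      (h' v : ℤ) - w (u, v) ≤ h' u := by
    intro u hu v hv he hle'
    have hwe := (abs_le.1 (hw _ he)).1
    have h₁ := hle v
    by_cases hul : l < h u ⌈/⌉ W
    · have h₂ : h' u = h u - 1 := if_pos hul
      rw [hhigh] at hul
      by_cases hvl : l < h v ⌈/⌉ W
      · have h₃ : h' v = h v - 1 := if_pos hvl
        rw [hhigh] at hvl
        omega
      · have := hlow v hv hvl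
        omega
    · have h₂ : h' u = h u := if_neg hul
      omega
  refine ⟨h', fun u hu => ⟨fun hV => ?_, fun hV v he => ?_⟩, ?_⟩
  · obtain ⟨v, hv, he, hle'⟩ := (hh u hu).1 hV
    exact ⟨v, hv, he, key u hu v hv he hle'⟩
  · obtain ⟨hv, hle'⟩ := (hh u hu).2 hV v he
    exact ⟨hv, key u hu v hv he hle'⟩
  · refine Finset.sum_lt_sum (fun v _ => hle v) ⟨v₀, Finset.mem_univ _, ?_⟩
    have h₁ : W * l < h v₀ := by
      refine lt_of_le_of_lt ?_ hlarge
      rw [mul_comm]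
      exact Nat.mul_le_mul_right _ (by omega)
    have h₂ : h' v₀ = h v₀ - 1 := if_pos ((hhigh v₀).2 h₁)
    omega

/-- Lowering repeatedly terminates because the sum of all values decreases. -/
theorem IsPotential.exists_bounded {w : V × V → ℤ} {S : Set V} {W : ℕ} (hW : 0 < W)
    (hw : ∀ e ∈ G.E, |w e| ≤ (W : ℤ)) {h : V → ℕ} (hh : IsPotential G w S h) :
    ∃ h', IsPotential G w S h' ∧ ∀ v ∈ S, h' v ≤ (Fintype.card V - 1) * W := by
  induction hN : ∑ v, h v using Nat.strong_induction_on generalizing h with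
  | _ N ih =>
    by_cases hb : ∀ v ∈ S, h v ≤ (Fintype.card V - 1) * W
    · exact ⟨h, hh, hb⟩
    · push Not at hb
      obtain ⟨v₀, _, hlarge⟩ := hb
      obtain ⟨h', hh', hlt⟩ := hh.exists_lower hW hw hlarge
      exact ih _ (hN ▸ hlt) hh' rfl

end Potentials

/-! ### Finite-horizon values -/

section Horizon

variable {V : Type} [Fintype V] [DecidableEq V] {G : GameGraph V}

/-- The credit that Player 0 needs to keep the energy non-negative during `t` moves, when she stays
in `S`. -/
def horizonVal (G : GameGraph V) (w : V × V → ℤ) (S : Set V) : ℕ → V → ℕ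
  | 0, _ => 0
  | t + 1, u =>
    if u ∈ G.V0 then
      -- Without a successor in `S` this is `sInf ∅ = 0`; the lemmas that need an optimal move
      -- assume that Player-0 nodes of `S` have a successor in `S`.
      sInf {x | ∃ v ∈ S, (u, v) ∈ G.E ∧ x = ((horizonVal G w S t v : ℤ) - w (u, v)).toNat}
    else (G.outEdges u).sup fun e => ((horizonVal G w S t e.dst : ℤ) - w e).toNat

variable {w : V × V → ℤ} {S : Set V}

theorem horizonVal_succ_le {t : ℕ} {u v : V} (hu : u ∈ G.V0) (hv : v ∈ S) (he : (u, v) ∈ G.E) :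
    horizonVal G w S (t + 1) u ≤ ((horizonVal G w S t v : ℤ) - w (u, v)).toNat := by
  rw [horizonVal, if_pos hu]
  exact Nat.sInf_le ⟨v, hv, he, rfl⟩

theorem le_horizonVal_succ {t : ℕ} {u v : V} (hu : u ∉ G.V0) (he : (u, v) ∈ G.E) :
    ((horizonVal G w S t v : ℤ) - w (u, v)).toNat ≤ horizonVal G w S (t + 1) u := by
  rw [horizonVal, if_neg hu]
  exact Finset.le_sup (f := fun e : G.Edge => ((horizonVal G w S t e.dst : ℤ) - w e).toNat)
    (b := ⟨(u, v), he⟩) (GameGraph.mem_outEdges.2 rfl)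

theorem exists_eq_horizonVal_succ (hG : ∀ v : V, ∃ v', (v, v') ∈ G.E)
    (hS₀ : ∀ u ∈ S, u ∈ G.V0 → ∃ v ∈ S, (u, v) ∈ G.E)
    (hS₁ : ∀ u ∈ S, u ∉ G.V0 → ∀ v, (u, v) ∈ G.E → v ∈ S) (t : ℕ) {u : V} (hu : u ∈ S) :
    ∃ v ∈ S, (u, v) ∈ G.E ∧
      horizonVal G w S (t + 1) u = ((horizonVal G w S t v : ℤ) - w (u, v)).toNat := by
  rw [horizonVal]
  by_cases hV : u ∈ G.V0
  · rw [if_pos hV]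
    obtain ⟨v, hv, he⟩ := hS₀ u hu hV
    exact Nat.sInf_mem (s := {x | ∃ v ∈ S, (u, v) ∈ G.E ∧
      x = ((horizonVal G w S t v : ℤ) - w (u, v)).toNat}) ⟨_, v, hv, he, rfl⟩
  · rw [if_neg hV]
    obtain ⟨e, he, h⟩ := Finset.exists_mem_eq_sup _ (G.outEdges_nonempty hG u)
      fun e => ((horizonVal G w S t e.dst : ℤ) - w e).toNat
    have hpair : e.1 = (u, e.dst) := Prod.ext (GameGraph.mem_outEdges.1 he) rfl
    have heE : (u, e.dst) ∈ G.E := hpair ▸ e.2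
    refine ⟨e.dst, hS₁ u hu hV _ heE, heE, ?_⟩
    rw [h, ← hpair]

theorem horizonVal_le_succ (hG : ∀ v : V, ∃ v', (v, v') ∈ G.E)
    (hS₀ : ∀ u ∈ S, u ∈ G.V0 → ∃ v ∈ S, (u, v) ∈ G.E)
    (hS₁ : ∀ u ∈ S, u ∉ G.V0 → ∀ v, (u, v) ∈ G.E → v ∈ S) (t : ℕ) :
    ∀ u ∈ S, horizonVal G w S t u ≤ horizonVal G w S (t + 1) u := by
  induction t with
  | zero => exact fun _ _ => Nat.zero_le _
  | succ t ih =>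
    intro u hu
    by_cases hV : u ∈ G.V0
    · obtain ⟨v, hv, he, h⟩ := exists_eq_horizonVal_succ (w := w) hG hS₀ hS₁ (t + 1) hu
      rw [h]
      refine (horizonVal_succ_le hV hv he).trans (Int.toNat_le_toNat ?_)
      have := ih v hv
      omega
    · obtain ⟨v, hv, he, h⟩ := exists_eq_horizonVal_succ (w := w) hG hS₀ hS₁ t hu
      rw [h]
      refine le_trans (Int.toNat_le_toNat ?_) (le_horizonVal_succ hV he)
      have := ih v hv
      omega

theorem horizonVal_mono (hG : ∀ v : V, ∃ v', (v, v') ∈ G.E)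
    (hS₀ : ∀ u ∈ S, u ∈ G.V0 → ∃ v ∈ S, (u, v) ∈ G.E)
    (hS₁ : ∀ u ∈ S, u ∉ G.V0 → ∀ v, (u, v) ∈ G.E → v ∈ S) {u : V} (hu : u ∈ S) :
    Monotone fun t => horizonVal G w S t u :=
  monotone_nat_of_le_succ fun t => horizonVal_le_succ hG hS₀ hS₁ t u hu

/-- Bounded values that increase with the horizon become stationary, and a stationary horizon value
is a potential. -/
theorem exists_isPotential_of_bounded (hG : ∀ v : V, ∃ v', (v, v') ∈ G.E)
    (hS₀ : ∀ u ∈ S, u ∈ G.V0 → ∃ v ∈ S, (u, v) ∈ G.E)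
    (hS₁ : ∀ u ∈ S, u ∉ G.V0 → ∀ v, (u, v) ∈ G.E → v ∈ S) {c : ℕ}
    (hc : ∀ u ∈ S, ∀ t, horizonVal G w S t u ≤ c) : ∃ h, IsPotential G w S h := by
  classical
  obtain ⟨t, ht⟩ : ∃ t, ∀ u ∈ S, horizonVal G w S (t + 1) u = horizonVal G w S t u := by
    -- Otherwise the sum of the values over `S` grows by at least one with every horizon and exceeds
    -- its bound.
    by_contra! hne
    have hsum : ∀ t, t ≤ ∑ u with u ∈ S, horizonVal G w S t u := by
      intro t
      induction t with
      | zero => exact Nat.zero_le _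
      | succ t ih =>
        obtain ⟨u, hu, h⟩ := hne t
        refine Nat.succ_le_of_lt (ih.trans_lt (Finset.sum_lt_sum (fun v hv => ?_) ⟨u, by simpa, ?_⟩))
        · exact horizonVal_le_succ hG hS₀ hS₁ t v (by simpa using hv)
        · exact lt_of_le_of_ne (horizonVal_le_succ hG hS₀ hS₁ t u hu) h.symm
    have hle : ∀ t, ∑ u with u ∈ S, horizonVal G w S t u ≤
        (Finset.univ.filter fun u => u ∈ S).card * c := fun t =>
      Finset.sum_le_card_nsmul _ _ _ fun u hu => hc u (by simpa using hu) t
    exact absurd ((hsum _).trans (hle _)) (Nat.not_succ_le_self _)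
  refine ⟨horizonVal G w S t, fun u hu => ⟨fun hV => ?_, fun hV v he => ⟨hS₁ u hu hV v he, ?_⟩⟩⟩
  · obtain ⟨v, hv, he, h⟩ := exists_eq_horizonVal_succ (w := w) hG hS₀ hS₁ t hu
    rw [ht u hu] at h
    exact ⟨v, hv, he, by omega⟩
  · have := le_horizonVal_succ (w := w) (S := S) (t := t) hV he
    rw [ht u hu] at this
    omega

end Horizon

/-! ### The winning region has a potential -/

section Spoiling

variable {V : Type} [Fintype V] [DecidableEq V] {G : GameGraph V}

theorem winRegion_of_player1 {φ : Set (ℕ → V)} (hφ : ∀ ρ ∈ φ, (fun j => ρ (j + 1)) ∈ φ) :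
    ∀ u ∈ G.winRegion φ, u ∉ G.V0 → ∀ v, (u, v) ∈ G.E → v ∈ G.winRegion φ := by
  rintro u ⟨π, hπ⟩ hu v he
  exact ⟨π.after u, hπ.after hφ he fun h => absurd h hu⟩

theorem winRegion_of_player0 {φ : Set (ℕ → V)} (hφ : ∀ ρ ∈ φ, (fun j => ρ (j + 1)) ∈ φ) :
    ∀ u ∈ G.winRegion φ, u ∈ G.V0 → ∃ v ∈ G.winRegion φ, (u, v) ∈ G.E := by
  rintro u ⟨π, hπ⟩ hu
  exact ⟨π.next [] u, ⟨π.after u, hπ.after hφ (π.valid [] u hu) fun _ => rfl⟩, π.valid [] u hu⟩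

variable (G) in
/-- A position in a play in which Player 1 spoils the objective: the strategy that Player 0 follows
from now on, the current node, the number of moves left to exhaust the credit, and the credit. -/
structure SpoilState where
  strat : G.Strategy
  node : V
  time : ℕ
  credit : ℤ

/-- A sequence of moves that follow the strategies of a sequence of positions is a play that follows
the first strategy. -/
theorem isPlay_of_spoilStates (s : ℕ → SpoilState G)
    (hE : ∀ n, ((s n).node, (s (n + 1)).node) ∈ G.E)
    (hnext : ∀ n, (s n).node ∈ G.V0 → (s (n + 1)).node = (s n).strat.next [] (s n).node)
    (hstrat : ∀ n, (s (n + 1)).strat = (s n).strat.after (s n).node) :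
    (s 0).strat.IsPlay fun n => (s n).node := by
  have h : ∀ n H u, (s n).strat.next H u =
      (s 0).strat.next ((List.range n).map (fun j => (s j).node) ++ H) u := by
    intro n
    induction n with
    | zero => exact fun _ _ => rfl
    | succ n ih =>
      intro H u
      rw [hstrat]
      refine (ih _ _).trans ?_
      rw [List.range_succ, List.map_append, List.append_assoc]
      rfl
  refine ⟨hE, fun j hj => ?_⟩
  have := h j [] (s j).node
  rw [List.append_nil] at this
  exact (hnext j hj).trans this

/-- If horizon values are unbounded somewhere, let Player 1 repeatedly use up a credit that is too
small for a horizon `N`, against a strategy that keeps winning. The play never leaves the nodes of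
unbounded value, and its weight drops at rate at least `1/N`, contradicting the mean-payoff
objective. -/
theorem exists_isPotential_winRegion (hG : ∀ v : V, ∃ v', (v, v') ∈ G.E) {φ : Set (ℕ → V)}
    (hφ : ∀ ρ ∈ φ, (fun j => ρ (j + 1)) ∈ φ) {w : V × V → ℤ} (hφw : φ ⊆ MeanPayoff w) {W : ℕ}
    (hw : ∀ e ∈ G.E, |w e| ≤ (W : ℤ)) : ∃ h, IsPotential G w (G.winRegion φ) h := by
  classical
  set S := G.winRegion φ with hS
  have hS₁ := winRegion_of_player1 (G := G) hφ
  have hS₀ := winRegion_of_player0 (G := G) hφ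
  rw [← hS] at hS₀ hS₁
  have hmono := fun {u : V} (hu : u ∈ S) => horizonVal_mono (w := w) hG hS₀ hS₁ hu
  -- the nodes of bounded value
  obtain ⟨K, hK⟩ : ∃ K : ℕ, ∀ u, (∃ c, ∀ t, horizonVal G w S t u ≤ c) →
      ∀ t, horizonVal G w S t u ≤ K := by
    have : ∀ u, ∃ c, (∃ c, ∀ t, horizonVal G w S t u ≤ c) → ∀ t, horizonVal G w S t u ≤ c := by
      intro u
      by_cases h : ∃ c, ∀ t, horizonVal G w S t u ≤ c
      · exact ⟨h.choose, fun _ => h.choose_spec⟩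
      · exact ⟨0, fun h' => absurd h' h⟩
    choose c hc using this
    exact ⟨∑ u, c u, fun u hu t =>
      (hc u hu t).trans (Finset.single_le_sum (fun _ _ => Nat.zero_le _) (Finset.mem_univ u))⟩
  by_cases hT : ∀ u ∈ S, ∃ c, ∀ t, horizonVal G w S t u ≤ c
  · exact exists_isPotential_of_bounded hG hS₀ hS₁ fun u hu => hK u (hT u hu)
  exfalso
  push Not at hT
  obtain ⟨v₀, hv₀, hv₀T⟩ := hT
  set T : Set V := {u | u ∈ S ∧ ∀ c, ∃ t, c < horizonVal G w S t u} with hTdef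
  -- Finitely many nodes and monotone values allow one horizon for all of `T`.
  obtain ⟨N, hN⟩ : ∃ N, ∀ u ∈ T, K + W < horizonVal G w S N u := by
    have : ∀ u, ∃ t, u ∈ T → K + W < horizonVal G w S t u := by
      intro u
      by_cases h : u ∈ T
      · exact (h.2 (K + W)).imp fun t ht _ => ht
      · exact ⟨0, fun h' => absurd h' h⟩
    choose t ht using this
    exact ⟨∑ u, t u, fun u hu => (ht u hu).trans_le (hmono hu.1
      (Finset.single_le_sum (fun _ _ => Nat.zero_le _) (Finset.mem_univ u)))⟩
  have hN0 : 0 < N := by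
    rcases Nat.eq_zero_or_pos N with rfl | h
    · exact absurd (hN v₀ ⟨hv₀, hv₀T⟩) (Nat.not_lt_zero _)
    · exact h
  -- The upper bound on the credit says that it is too small for the remaining time. The lower bound
  -- `K + W` keeps it at least `K` after any single move, which forces the next node into `T`.
  let Inv : SpoilState G → Prop := fun s => s.strat.WinsFrom φ s.node ∧ s.node ∈ T ∧ s.time ≤ N ∧
    (K + W : ℤ) ≤ s.credit ∧ s.credit < horizonVal G w S s.time s.node
  -- `N · credit - time` gains at least `N · w + 1` per move. An ordinary move adds `w` to the
  -- credit and uses one unit of time. A reset raises the updated credit by at least one, and these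
  -- `N` units outweigh the restored time.
  have hstep : ∀ s : {s // Inv s}, ∃ s' : {s // Inv s}, (s.1.node, s'.1.node) ∈ G.E ∧
      (s.1.node ∈ G.V0 → s'.1.node = s.1.strat.next [] s.1.node) ∧
      s'.1.strat = s.1.strat.after s.1.node ∧
      (N : ℤ) * w (s.1.node, s'.1.node) + 1 + (N * s.1.credit - s.1.time) ≤
        N * s'.1.credit - s'.1.time := by
    rintro ⟨⟨π, u, t, c⟩, hπ, hu, ht, hKc, hc⟩
    dsimp only at hπ hu ht hKc hc ⊢
    obtain ⟨t, rfl⟩ : ∃ t', t = t' + 1 := by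
      -- At time `0` the needed credit is `0`, while the credit is non-negative.
      refine Nat.exists_eq_succ_of_ne_zero fun h => ?_
      subst h
      have : c < 0 := hc
      omega
    obtain ⟨v, hv, he, hnext, hcv⟩ : ∃ v ∈ S, (u, v) ∈ G.E ∧ (u ∈ G.V0 → v = π.next [] u) ∧
        c + w (u, v) < horizonVal G w S t v := by
      by_cases hV : u ∈ G.V0
      · have he := π.valid [] u hV
        have hv : π.next [] u ∈ S := ⟨π.after u, hπ.after hφ he fun _ => rfl⟩
        refine ⟨_, hv, he, fun _ => rfl, ?_⟩
        have := horizonVal_succ_le (w := w) (t := t) hV hv he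
        omega
      · obtain ⟨v, hv, he, h⟩ := exists_eq_horizonVal_succ (w := w) hG hS₀ hS₁ t hu.1
        refine ⟨v, hv, he, fun h => absurd h hV, ?_⟩
        omega
    have hwe := (abs_le.1 (hw _ he)).1
    have hvT : v ∈ T := by
      refine ⟨hv, ?_⟩
      by_contra hb
      push Not at hb
      have := hK v hb t
      omega
    have hπ' := hπ.after hφ he hnext
    by_cases hcK : (K + W : ℤ) ≤ c + w (u, v)
    · refine ⟨⟨⟨π.after u, v, t, c + w (u, v)⟩, hπ', hvT, Nat.le_of_succ_le ht, hcK, hcv⟩, he, hnext, rfl, ?_⟩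
      dsimp only
      push_cast
      linarith
    · refine ⟨⟨⟨π.after u, v, N, K + W⟩, hπ', hvT, le_rfl, le_rfl, ?_⟩, he, hnext, rfl, ?_⟩
      · change (K + W : ℤ) < (horizonVal G w S N v : ℤ)
        exact_mod_cast hN v hvT
      · dsimp only
        push_cast
        have h₁ : c + w (u, v) + 1 ≤ (K + W : ℤ) := by omega
        have h₂ := mul_le_mul_of_nonneg_left h₁ (Int.natCast_nonneg N)
        have h₃ : (0 : ℤ) ≤ t := Int.natCast_nonneg t
        linarith
  choose next hnextE hnext0 hnextS hnextC using hstep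
  obtain ⟨π, hπ⟩ := hv₀
  let s₀ : {s // Inv s} := ⟨⟨π, v₀, N, K + W⟩, hπ, ⟨⟨π, hπ⟩, hv₀T⟩, le_rfl, le_rfl, by
    change (K + W : ℤ) < (horizonVal G w S N v₀ : ℤ)
    exact_mod_cast hN v₀ ⟨⟨π, hπ⟩, hv₀T⟩⟩
  let s : ℕ → {s // Inv s} := fun n => next^[n] s₀
  have hs : ∀ n, s (n + 1) = next (s n) := fun n => Function.iterate_succ_apply' _ _ _
  have hplay := isPlay_of_spoilStates (fun n => (s n).1)
    (fun n => by rw [hs]; exact hnextE _) (fun n => by rw [hs]; exact hnext0 _)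
    (fun n => by rw [hs]; exact hnextS _)
  have hmp := mem_meanPayoff_iff.1 (hφw (hπ _ hplay rfl))
  set ρ : ℕ → V := fun n => (s n).1.node with hρ
  -- Telescoping: as the credit is bounded, `N` times the total weight of `n` moves is at most a
  -- constant minus `n`.
  have hsum : ∀ n, (N : ℤ) * ∑ j ∈ Finset.range n, w (ρ j, ρ (j + 1)) + n + (N * (K + W) - N) ≤
      N * (s n).1.credit - (s n).1.time := by
    intro n
    induction n with
    | zero => simp [s, s₀]
    | succ n ih =>
      have := hnextC (s n)
      rw [← hs] at this
      rw [Finset.sum_range_succ]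
      push_cast
      have e : w ((s n).1.node, (s (n + 1)).1.node) = w (ρ n, ρ (n + 1)) := rfl
      rw [e] at this
      linarith
  have hcredit : ∀ n, (s n).1.credit ≤ ((∑ u, horizonVal G w S N u : ℕ) : ℤ) := by
    intro n
    obtain ⟨_, h₁, h₂, _, h₃⟩ := (s n).2
    have h₄ := hmono h₁.1 h₂
    have h₅ := Finset.single_le_sum (f := horizonVal G w S N) (fun _ _ => Nat.zero_le _)
      (Finset.mem_univ (s n).1.node)
    dsimp only at h₄
    omega
  set D := ∑ u, horizonVal G w S N u with hD
  have hN0' : (0 : ℝ) < N := by exact_mod_cast hN0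
  -- Tolerance `1/(2N)` is half the rate of loss, so the contradiction appears once `n/2` exceeds
  -- the constant `N · D + N`.
  obtain ⟨n, hn, hle⟩ := frequently_atTop.1 (hmp (1 / (2 * N)) (by positivity)) (2 * (N * D + N) + 1)
  have h₁ : (N : ℤ) * ∑ j ∈ Finset.range n, w (ρ j, ρ (j + 1)) + n ≤ N * D + N := by
    have h₂ := hsum n
    have h₃ := mul_le_mul_of_nonneg_left (hcredit n) (Int.natCast_nonneg N)
    have h₄ : (0 : ℤ) ≤ N * (K + W) := by positivity
    have h₅ : (0 : ℤ) ≤ (s n).1.time := Int.natCast_nonneg _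
    linarith
  have h₁' : (N : ℝ) * ((∑ j ∈ Finset.range n, w (ρ j, ρ (j + 1)) : ℤ) : ℝ) + n ≤ N * D + N := by
    exact_mod_cast h₁
  have hn' : (2 * (N * D + N) + 1 : ℝ) ≤ n := by exact_mod_cast hn
  have h₂ := mul_le_mul_of_nonneg_left hle hN0'.le
  have h₃ : (N : ℝ) * (-(1 / (2 * N)) * n) = -(n / 2) := by field_simp
  rw [h₃] at h₂
  linarith

end Spoiling

/-! ### The procedure keeps the winning region -/

section Soundness

variable {V : Type} [Fintype V] [DecidableEq V] {G : GameGraph V} {k : ℕ}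

open Classical in
/-- The edge function of a potential on `S`. -/
def edgeBound (G : GameGraph V) (w : V × V → ℤ) (S : Set V) (h : V → ℕ) (e : G.Edge) : ℕ∞ :=
  if e.src ∈ S ∧ e.dst ∈ S then (((h e.dst : ℤ) - w e).toNat : ℕ∞) else ⊤

theorem IsPotential.nodeVal_edgeBound_le {w : V × V → ℤ} {S : Set V} {h : V → ℕ}
    (hh : IsPotential G w S h) {v : V} (hv : v ∈ S) :
    nodeVal G (edgeBound G w S h) v ≤ h v := by
  unfold nodeVal
  split_ifs with hV
  · obtain ⟨u, hu, he, hle⟩ := (hh v hv).1 hV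
    refine (Finset.inf_le (GameGraph.mem_outEdges (e := ⟨(v, u), he⟩).2 rfl)).trans ?_
    rw [edgeBound, if_pos ⟨hv, hu⟩]
    exact_mod_cast Int.toNat_le.2 hle
  · refine Finset.sup_le fun e he => ?_
    have hpair : e.1 = (v, e.dst) := Prod.ext (GameGraph.mem_outEdges.1 he) rfl
    obtain ⟨hu, hle⟩ := (hh v hv).2 hV e.dst (hpair ▸ e.2)
    rw [← hpair] at hle
    rw [edgeBound, if_pos ⟨(GameGraph.mem_outEdges.1 he).symm ▸ hv, hu⟩]
    exact_mod_cast Int.toNat_le.2 hle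

/-- A value at most `(|V| - 1) · W` changes by at most `W` along an edge, so it stays within the
cut-off `|V| · W`. -/
theorem IsPotential.isStable_edgeBound [Nonempty V] {w : V × V → ℤ} {S : Set V} {W : ℕ}
    (hw : ∀ e ∈ G.E, |w e| ≤ (W : ℤ)) {h : V → ℕ} (hh : IsPotential G w S h)
    (hb : ∀ v ∈ S, h v ≤ (Fintype.card V - 1) * W) : IsStable w W (edgeBound G w S h) := by
  intro e
  by_cases he : e.src ∈ S ∧ e.dst ∈ S
  · have h₁ : edgeBound G w S h e = (((h e.dst : ℤ) - w e).toNat : ℕ∞) := if_pos he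
    have h₂ : ominus (nodeVal G (edgeBound G w S h) e.dst) (w e) ≤
        (((h e.dst : ℤ) - w e).toNat : ℕ∞) :=
      ominus_mono (hh.nodeVal_edgeBound_le he.2) _
    rw [h₁, truncAt_of_le]
    · exact h₂
    · refine h₂.trans ?_
      have h₃ := hb _ he.2
      have h₄ := (abs_le.1 (hw _ e.2)).1
      have h₅ : Fintype.card V * W = (Fintype.card V - 1) * W + W := by
        rw [← Nat.succ_mul, Nat.succ_eq_add_one, Nat.sub_add_cancel Fintype.card_pos]
      exact_mod_cast Int.toNat_le.2 (by omega)
  · rw [edgeBound, if_neg he]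
    exact le_top

variable {w : Fin k → V × V → ℤ} {W : ℕ}

/-- The induction carries that all activation values are below `g`. Pruned edges end outside `𝒲'`,
hence outside `S`, where `g` is `⊤` anyway; and value iteration started below a stable function
stays below it. -/
theorem subset_reg'_loopIter (hG : ∀ v : V, ∃ v', (v, v') ∈ G.E) {S : Set V}
    {g : Fin k → G.Edge → ℕ∞} (hstable : ∀ i, IsStable (w i) W (g i))
    (hfin : ∀ i, ∀ v ∈ S, nodeVal G (g i) v ≠ ⊤)
    (htop : ∀ i, ∀ e : G.Edge, e.dst ∉ S → g i e = ⊤) (j : ℕ) :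
    S ⊆ (loopIter G w W j).reg' := by
  have hsub : ∀ j, (∀ i, ((loopIter G w W j).tmpl i).act ≤ g i) →
      S ⊆ (loopIter G w W j).reg' := by
    intro j hle v hv
    rw [reg'_loopIter, Set.mem_iInter]
    exact fun i => regionOf_anti (hle i) (mem_regionOf.2 (hfin i v hv))
  refine hsub j ?_
  induction j with
  | zero =>
    intro i
    rw [act_loopIter_zero]
    exact fixPoint_le hG (fun _ => bot_le) (hstable i)
  | succ j ih =>
    intro i
    rw [act_loopIter_succ]
    refine fixPoint_le hG (fun e => ?_) (hstable i)
    unfold LoopState.pruned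
    split_ifs with h
    · rw [htop i e fun hS => h.2.2 (hsub j ih hS)]
    · exact ih i e

theorem winRegion_subset_reg'_loopIter [Nonempty V] (hG : ∀ v : V, ∃ v', (v, v') ∈ G.E)
    (hW : 0 < W) (hw : ∀ i, ∀ e ∈ G.E, |w i e| ≤ (W : ℤ)) (j : ℕ) :
    G.winRegion (⋂ i, MeanPayoff (w i)) ⊆ (loopIter G w W j).reg' := by
  have hφ : ∀ ρ ∈ ⋂ i, MeanPayoff (w i), (fun j => ρ (j + 1)) ∈ ⋂ i, MeanPayoff (w i) :=
    fun ρ hρ => Set.mem_iInter.2 fun i => meanPayoff_tail (Set.mem_iInter.1 hρ i)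
  have : ∀ i, ∃ h, IsPotential G (w i) (G.winRegion (⋂ i, MeanPayoff (w i))) h ∧
      ∀ v ∈ G.winRegion (⋂ i, MeanPayoff (w i)), h v ≤ (Fintype.card V - 1) * W := fun i => by
    obtain ⟨h, hh⟩ := exists_isPotential_winRegion hG hφ (Set.iInter_subset _ i) (hw i)
    exact hh.exists_bounded hW (hw i)
  choose h hh hb using this
  refine subset_reg'_loopIter hG (g := fun i => edgeBound G (w i) _ (h i))
    (fun i => (hh i).isStable_edgeBound (hw i) (hb i)) (fun i v hv htop => ?_)
    (fun i e he => if_neg fun h => he h.2) j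
  have := (hh i).nodeVal_edgeBound_le hv
  rw [htop] at this
  exact absurd this (by simp)

/-- The target either leaves the region in the current round, and then the edge is pruned, or it
left earlier, and then the value was already `⊤` and has not dropped. -/
theorem act_loopIter_eq_top (j : ℕ) (i : Fin k) (e : G.Edge)
    (hsrc : e.src ∈ (loopIter G w W j).reg) (hdst : e.dst ∉ (loopIter G w W j).reg) :
    ((loopIter G w W j).tmpl i).act e = ⊤ := by
  induction j with
  | zero => exact absurd (Set.mem_univ _) hdst
  | succ j ih =>
    rw [reg_loopIter_succ] at hsrc hdst
    rw [act_loopIter_succ]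
    refine top_le_iff.1 (le_trans ?_ (le_fixPoint _ _ _ e))
    unfold LoopState.pruned
    split_ifs with h
    · exact le_rfl
    · have hsrc' := reg'_loopIter_subset j hsrc
      exact (ih hsrc' fun h' => h ⟨hsrc, h', hdst⟩).ge

theorem isStable_loopIter (hG : ∀ v : V, ∃ v', (v, v') ∈ G.E) (j : ℕ) (i : Fin k) :
    IsStable (w i) W ((loopIter G w W j).tmpl i).act := by
  cases j with
  | zero =>
    rw [act_loopIter_zero]
    exact isStable_fixPoint hG fun _ => .inl bot_le
  | succ j =>
    rw [act_loopIter_succ]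
    exact isStable_fixPoint hG (isCutValue_pruned (isCutValue_loopIter j i))

end Soundness

/-! ### Combining positional strategies -/

section Combine

variable {V : Type} [Fintype V] [DecidableEq V] {G : GameGraph V} {k : ℕ} [NeZero k]

theorem take_playPrefix (ρ : ℕ → V) {t n : ℕ} (h : t + 1 ≤ n) :
    (playPrefix ρ n).take (t + 2) = playPrefix ρ (t + 1) := by
  rw [playPrefix, ← List.map_take, List.take_range, min_eq_left (by omega), playPrefix]

/-- The phase after `t` moves depends on these moves only. -/
theorem phaseAt_playPrefix (w : Fin k → V × V → ℤ) (ρ : ℕ → V) {t n : ℕ} (h : t ≤ n) :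
    phaseAt w (playPrefix ρ n) t = phaseAt w (playPrefix ρ t) t := by
  induction t generalizing n with
  | zero => rfl
  | succ t ih =>
    simp only [phaseAt]
    rw [take_playPrefix ρ h, take_playPrefix ρ le_rfl, ih (n := n) (by omega),
      ih (n := t + 1) (by omega)]

/-- In every phase the weight served is bounded below, so the phase ends. -/
theorem exists_phase_end {w : Fin k → V × V → ℤ} {πs : Fin k → G.Positional} {U : Set V}
    {f : Fin k → V → ℕ}
    (h₀ : ∀ i, ∀ u ∈ U, u ∈ G.V0 →
      (πs i).next u ∈ U ∧ (f i ((πs i).next u) : ℤ) - w i (u, (πs i).next u) ≤ f i u)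
    (h₁ : ∀ i, ∀ u ∈ U, u ∉ G.V0 → ∀ v, (u, v) ∈ G.E →
      v ∈ U ∧ (f i v : ℤ) - w i (u, v) ≤ f i u)
    {ρ : ℕ → V} (hρ : (combineStrat w πs).IsPlay ρ) (hρ0 : ρ 0 ∈ U) (p : ℕ) :
    ∃ t, phaseAt w (playPrefix ρ t) t = p ∧
      -(1 / ((p : ℝ) + 1)) ≤ pathAvg (w (phaseObj k p)) (playPrefix ρ (t + 1)) := by
  set ph : ℕ → ℕ := fun t => phaseAt w (playPrefix ρ t) t with hph
  have hph_succ : ∀ t, ph (t + 1) =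
      if -(1 / ((ph t : ℝ) + 1)) ≤ pathAvg (w (phaseObj k (ph t))) (playPrefix ρ (t + 1))
      then ph t + 1 else ph t := by
    intro t
    simp only [hph]
    rw [phaseAt, take_playPrefix ρ le_rfl, phaseAt_playPrefix w ρ (Nat.le_succ t)]
  have hmove : ∀ t, ρ t ∈ G.V0 → ρ (t + 1) = (πs (phaseObj k (ph t))).next (ρ t) := by
    intro t ht
    have h : (List.range t).map ρ ++ [ρ t] = playPrefix ρ t := by
      rw [playPrefix, List.range_succ, List.map_append]
      rfl
    rw [hρ.2 t ht, combineStrat]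
    dsimp only
    rw [h, List.length_map, List.length_range]
  have hstep : ∀ t, ρ t ∈ U → ρ (t + 1) ∈ U ∧
      (f (phaseObj k (ph t)) (ρ (t + 1)) : ℤ) - w (phaseObj k (ph t)) (ρ t, ρ (t + 1)) ≤
        f (phaseObj k (ph t)) (ρ t) := by
    intro t ht
    by_cases hV : ρ t ∈ G.V0
    · rw [hmove t hV]
      exact h₀ _ _ ht hV
    · exact h₁ _ _ ht hV _ (hρ.1 t)
  -- All the strategies stay in `U`, so changing the phase does no harm.
  have hU : ∀ t, ρ t ∈ U := by
    intro t
    induction t with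
    | zero => exact hρ0
    | succ t ih => exact (hstep t ih).1
  -- a phase that is entered ends
  have hend : ∀ t₀ p, ph t₀ = p → ∃ t, ph t = p ∧
      -(1 / ((p : ℝ) + 1)) ≤ pathAvg (w (phaseObj k p)) (playPrefix ρ (t + 1)) := by
    intro t₀ p hp
    by_contra! hne
    have hconst : ∀ d, ph (t₀ + d) = p := by
      intro d
      induction d with
      | zero => exact hp
      | succ d ih =>
        rw [← Nat.add_assoc, hph_succ, ih, if_neg (not_le.2 (hne _ ih))]
    set i := phaseObj k p with hi
    -- In an endless phase the total weight for `i` never falls below `c`, the weight collected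
    -- before the phase minus the credit at its start; so the average tends to a non-negative limit
    -- inferior and passes `-1/(p+1)`.
    set c : ℤ := ∑ j ∈ Finset.range t₀, w i (ρ j, ρ (j + 1)) - f i (ρ t₀) with hc
    have hsum : ∀ d, c + f i (ρ (t₀ + d)) ≤
        ∑ j ∈ Finset.range (t₀ + d), w i (ρ j, ρ (j + 1)) := by
      intro d
      induction d with
      | zero =>
        rw [hc, Nat.add_zero]
        omega
      | succ d ih =>
        have := (hstep (t₀ + d) (hU _)).2
        rw [hconst, ← hi] at this
        rw [← Nat.add_assoc, Finset.sum_range_succ]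
        omega
    obtain ⟨a, ha⟩ := exists_nat_gt (-(c : ℝ) * (p + 1))
    have hp0 : (0 : ℝ) < p + 1 := by positivity
    refine absurd (hne (t₀ + a) (hconst a)) (not_lt.2 ?_)
    rw [pathAvg_playPrefix, le_div_iff₀ (by positivity)]
    have hs : (c : ℝ) ≤
        ((∑ j ∈ Finset.range (t₀ + a + 1), w i (ρ j, ρ (j + 1)) : ℤ) : ℝ) := by
      have := hsum (a + 1)
      rw [← Nat.add_assoc] at this
      exact_mod_cast (by omega : c ≤ ∑ j ∈ Finset.range (t₀ + a + 1), w i (ρ j, ρ (j + 1)))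
    refine le_trans ?_ hs
    have h₂ : (a : ℝ) ≤ ((t₀ + a + 1 : ℕ) : ℝ) := by exact_mod_cast (by omega : a ≤ t₀ + a + 1)
    have h₃ : -(c : ℝ) ≤ ((t₀ + a + 1 : ℕ) : ℝ) / (p + 1) := by
      rw [le_div_iff₀ hp0]
      linarith
    have h₄ : -(1 / ((p : ℝ) + 1)) * ((t₀ + a + 1 : ℕ) : ℝ) =
        -(((t₀ + a + 1 : ℕ) : ℝ) / (p + 1)) := by ring
    rw [h₄]
    linarith
  suffices h : ∃ t, ph t = p from h.elim fun t ht => hend t p ht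
  induction p with
  | zero => exact ⟨0, rfl⟩
  | succ p ih =>
    obtain ⟨t₀, ht₀⟩ := ih
    obtain ⟨t, ht, hle⟩ := hend t₀ p ht₀
    exact ⟨t + 1, by rw [hph_succ, ht, if_pos hle]⟩

theorem phaseAt_le (w : Fin k → V × V → ℤ) (h : List V) (t : ℕ) : phaseAt w h t ≤ t := by
  induction t with
  | zero => exact le_rfl
  | succ t ih =>
    rw [phaseAt]
    split_ifs <;> omega

theorem combineStrat_winsFrom {w : Fin k → V × V → ℤ} {πs : Fin k → G.Positional} {U : Set V}
    {f : Fin k → V → ℕ}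
    (h₀ : ∀ i, ∀ u ∈ U, u ∈ G.V0 →
      (πs i).next u ∈ U ∧ (f i ((πs i).next u) : ℤ) - w i (u, (πs i).next u) ≤ f i u)
    (h₁ : ∀ i, ∀ u ∈ U, u ∉ G.V0 → ∀ v, (u, v) ∈ G.E →
      v ∈ U ∧ (f i v : ℤ) - w i (u, v) ≤ f i u)
    {v : V} (hv : v ∈ U) : (combineStrat w πs).WinsFrom (⋂ i, MeanPayoff (w i)) v := by
  rintro ρ hρ rfl
  refine Set.mem_iInter.2 fun i => mem_meanPayoff_iff.2 fun ε hε => frequently_atTop.2 fun a => ?_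
  obtain ⟨b, hb⟩ := exists_nat_gt (1 / ε)
  have hk : 1 ≤ k := NeZero.pos k
  -- This phase serves `i`, ends after time `a` since a phase number never exceeds the number of
  -- moves, and has tolerance below `ε` since `p ≥ b > 1/ε`.
  set p := i.1 + k * (a + b) with hp
  have hab : a + b ≤ p := (Nat.le_mul_of_pos_left _ hk).trans (Nat.le_add_left _ _)
  have hobj : phaseObj k p = i := Fin.ext (by
    change p % k = i.1
    rw [hp, Nat.add_mul_mod_self_left, Nat.mod_eq_of_lt i.2])
  obtain ⟨t, ht, hle⟩ := exists_phase_end h₀ h₁ hρ hv p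
  have hpt : p ≤ t := ht ▸ phaseAt_le _ _ _
  refine ⟨t + 1, by omega, ?_⟩
  rw [hobj, pathAvg_playPrefix, le_div_iff₀ (by positivity)] at hle
  refine le_trans (mul_le_mul_of_nonneg_right (neg_le_neg ?_) (Nat.cast_nonneg _)) hle
  have hbp : (b : ℝ) ≤ p := by exact_mod_cast (by omega : b ≤ p)
  rw [div_lt_iff₀ hε] at hb
  rw [div_le_iff₀ (by positivity)]
  nlinarith [mul_le_mul_of_nonneg_right hbp hε.le]

/-- Every strategy returned by `CombineQaSTel` is winning. -/
theorem CombineReturns.isWinning [Nonempty V] (hG : ∀ v : V, ∃ v', (v, v') ∈ G.E)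
    {w : Fin k → V × V → ℤ} {W : ℕ} (hW : 0 < W) (hw : ∀ i, ∀ e ∈ G.E, |w i e| ≤ (W : ℤ))
    {π : G.Strategy} (hπ : CombineReturns w W π) : π.IsWinning (⋂ i, MeanPayoff (w i)) := by
  obtain ⟨j, _, hreg, πs, hext, rfl⟩ := hπ
  change (loopIter G w W j).reg = (loopIter G w W j).reg' at hreg
  change ∀ i, IsExtracted ((loopIter G w W j).tmpl i) (πs i) at hext
  intro v hv
  set U := (loopIter G w W j).reg' with hU
  set μ : Fin k → G.Edge → ℕ∞ := fun i => ((loopIter G w W j).tmpl i).act with hμ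
  have hfin : ∀ i, ∀ u ∈ U, nodeVal G (μ i) u ≠ ⊤ := by
    intro i u hu
    rw [hU, reg'_loopIter] at hu
    exact mem_regionOf.1 (Set.mem_iInter.1 hu i)
  have hcoe : ∀ i, ∀ u ∈ U, ((nodeVal G (μ i) u).toNat : ℕ∞) = nodeVal G (μ i) u :=
    fun i u hu => ENat.natCast_toNat (hfin i u hu)
  -- Applies to extracted edges, whose value is the minimum at their source, and to all edges of
  -- Player-1 nodes, whose value is at most the maximum.
  have hedge : ∀ i, ∀ e : G.Edge, e.src ∈ U → μ i e ≤ nodeVal G (μ i) e.src → e.dst ∈ U ∧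
      ((nodeVal G (μ i) e.dst).toNat : ℤ) - w i e ≤ (nodeVal G (μ i) e.src).toNat := by
    intro i e he hle
    have hne : μ i e ≠ ⊤ := (hle.trans_lt (lt_top_iff_ne_top.2 (hfin i _ he))).ne
    have hdst : e.dst ∈ U := by
      by_contra hd
      rw [← hreg] at he hd
      exact hne (act_loopIter_eq_top j i e he hd)
    refine ⟨hdst, ?_⟩
    -- The cut-off only raises values, so it may be dropped from the stability inequality.
    have h₁ := ((le_truncAt _ _).trans (isStable_loopIter hG j i e)).trans hle
    change ominus (nodeVal G (μ i) e.dst) (w i e) ≤ _ at h₁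
    rw [← hcoe i _ he] at h₁
    obtain ⟨l, hl, hle'⟩ := ominus_le_coe.1 h₁
    rwa [hl]
  refine combineStrat_winsFrom (U := U) (f := fun i u => (nodeVal G (μ i) u).toNat) ?_ ?_
    (winRegion_subset_reg'_loopIter hG hW hw j hv)
  · intro i u hu hV
    refine hedge i ⟨(u, (πs i).next u), (πs i).valid u hV⟩ hu ?_
    obtain ⟨e, he, h⟩ := exists_eq_nodeVal hG (μ i) u
    exact (hext i u hV e he).trans h.le
  · intro i u hu hV v' he
    exact hedge i ⟨(u, v'), he⟩ hu (le_nodeVal_of_notMem hV)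

end Combine

theorem mainTheorem6 :
    ∃ C : ℕ, ∀ (V : Type) [Fintype V] [DecidableEq V] [Nonempty V] (G : GameGraph V)
      (_hG : ∀ v : V, ∃ v' : V, (v, v') ∈ G.E)
      (k : ℕ) [NeZero k] (w : Fin k → V × V → ℤ) (W : ℕ) (_hW : 0 < W)
      (_hw : ∀ i, ∀ e ∈ G.E, |w i e| ≤ (W : ℤ)),
      -- whatever the procedure returns is winning for the conjunction
      (∀ π : G.Strategy, CombineReturns w W π → π.IsWinning (⋂ i, MeanPayoff (w i))) ∧
      -- the procedure halts in time, whatever the memory holds at the start, and returns a strategy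
      (∀ m₀ : Memory G k, ∃ (m : Memory G k) (r : ℕ) (πs : Fin k → G.Positional),
        (Impl.combineQaSTel G w W).run (C * (k * Fintype.card V * G.E.card * W)) m₀
          = some ((), m, r) ∧
        (∀ i, ∀ v ∈ G.V0, (m.choice i v).map (fun e => e.1) = some (v, (πs i).next v)) ∧
        CombineReturns w W (combineStrat w πs)) := by
  -- The estimates add up to `38 + 106 + 100 = 244`: value iteration, overhead of the rounds, and
  -- initialisation with extraction.
  refine ⟨300, ?_⟩
  intro V _ _ _ G hG k _ w W hW hw
  exact ⟨fun π hπ => hπ.isWinning hG hW hw, Impl.combineQaSTel_halts hG w hW⟩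

end
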